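/- There exist absolute constants $c > 0$ and $K \in \mathbb{N}$ such that the following holds. Let $I \subseteq \mathbb{R}$ be a convex set (an interval), let $f$ be a real-valued function that is strictly convex on $I$ or strictly concave on $I$, and let $A \subseteq I$ be a finite set. Write $f(A) = \{f(a) : a \in A\}$ and $X + Y = \{x + y : x \in X,\ y \in Y\}$. Then $$|A + f(A)| \ \ge\ \frac{c\,|A|^{49/38}}{(1 + \log |A|)^{K}}$$ and $$|A + A| + |f(A) + f(A)| \ \ge\ \frac{c\,|A|^{49/38}}{(1 + \log |A|)^{K}},$$ where for $A = \emptyset$ both right-hand sides are read as $0$. -/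

import Mathlib

open scoped Pointwise

/-! Write n = |A|, F = f(A), E₃(A) for the sum of cubes of the representation counts in A - A, and ≲
for inequality up to logarithms and constants. Strict convexity makes the graph of f a curve whose
nonzero difference vectors determine their endpoints, after passing to a third of A on which f is
strictly monotone. This gives a Szemerédi–Trotter bound for translates of the graph against
Cartesian products (`szemerediTrotter_curveHits`), proved by an elementary cell count.

Incidences yield third-moment bounds D(A): the representation counts in A - X have cube sum at most
D(A)|X|² for every X. If many points of F have many representations q + c, with q in F and c in a
popular-difference set, that structure feeds the incidence bound. After pruning F so that every
remaining point carries its share of E₃(F) on one common dyadic level, the scale of the level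
cancels and D(A)E₃(F) ≲ n⁵ (`exists_subset_cubeBound`). Doing this in both coordinates also gives
D(F)E₃(A) ≲ n⁵.

A Katz–Koester argument (`katzKoester_bound`) bounds the additive energy of a large part of a set by
its sumset size, third-moment constants and third energies: popular differences of A give many pairs
of sums with the same difference, and these are counted by Cauchy–Schwarz and Hölder. Since a small
sumset forces large additive energy, the bounds for A and B combine to m¹¹⁴ ≲ (E₃(A)E₃(B))⁸
(D(A)D(B))³ |A+B|³⁸ when |A| = |B| = m.

Put U = E₃(A)E₃(F) and V = D(A)D(F). Then UV ≲ n¹⁰, and U ≤ Vn⁴ because E₃ ≤ Dn². Hence U¹⁶V⁶ =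
(UV)⁶(U²)⁵ ≲ n¹³⁰, so the square of the inequality leaves n⁹⁸ ≲ |A+F|⁷⁶, which is the exponent
49/38. For the second claim, multiply the inequalities for the pairs (A, A) and (F, F): the same U
and V appear, with |A+A||F+F| in place of |A+F|². -/

/-! ### Sidon curves. -/

/-- The number of representations of `y` as a difference `a - b` with `a ∈ A`, `b ∈ B`. -/
noncomputable def diffRep (A B : Finset ℝ) (y : ℝ) : ℕ := ((A ×ˢ B).filter fun p => p.1 - p.2 = y).card

/-- A finite monotone or antitone set in the plane with injective projections, all of whose
nonzero difference vectors are represented only once. -/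
structure IsSidonCurve (Γ : Finset (ℝ × ℝ)) : Prop where
  injOn_fst : Set.InjOn Prod.fst (Γ : Set (ℝ × ℝ))
  injOn_snd : Set.InjOn Prod.snd (Γ : Set (ℝ × ℝ))
  sidon : ∀ p ∈ Γ, ∀ q ∈ Γ, ∀ p' ∈ Γ, ∀ q' ∈ Γ, p ≠ q → p - q = p' - q' → p = p'
  mono : (∀ p ∈ Γ, ∀ q ∈ Γ, p.1 ≤ q.1 → p.2 ≤ q.2) ∨ (∀ p ∈ Γ, ∀ q ∈ Γ, p.1 ≤ q.1 → q.2 ≤ p.2)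

theorem IsSidonCurve.subset {Γ Δ : Finset (ℝ × ℝ)} (h : IsSidonCurve Γ) (hΔ : Δ ⊆ Γ) :
    IsSidonCurve Δ where
  injOn_fst := h.injOn_fst.mono (by exact_mod_cast hΔ)
  injOn_snd := h.injOn_snd.mono (by exact_mod_cast hΔ)
  sidon p hp q hq p' hp' q' hq' :=
    h.sidon p (hΔ hp) q (hΔ hq) p' (hΔ hp') q' (hΔ hq')
  mono := h.mono.imp (fun H p hp q hq => H p (hΔ hp) q (hΔ hq))
    (fun H p hp q hq => H p (hΔ hp) q (hΔ hq))

theorem IsSidonCurve.swap {Γ : Finset (ℝ × ℝ)} (h : IsSidonCurve Γ) :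
    IsSidonCurve (Γ.image Prod.swap) where
  injOn_fst := by
    intro p hp q hq hpq
    simp only [Finset.coe_image, Set.mem_image, Finset.mem_coe] at hp hq
    obtain ⟨p, hp, rfl⟩ := hp
    obtain ⟨q, hq, rfl⟩ := hq
    rw [h.injOn_snd hp hq hpq]
  injOn_snd := by
    intro p hp q hq hpq
    simp only [Finset.coe_image, Set.mem_image, Finset.mem_coe] at hp hq
    obtain ⟨p, hp, rfl⟩ := hp
    obtain ⟨q, hq, rfl⟩ := hq
    rw [h.injOn_fst hp hq hpq]
  sidon := by
    simp only [Finset.forall_mem_image]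
    intro p hp q hq p' hp' q' hq' hne he
    have := h.sidon p hp q hq p' hp' q' hq' (fun e => hne (by rw [e]))
      (by simpa [Prod.ext_iff, and_comm] using he)
    rw [this]
  mono := by
    simp only [Finset.forall_mem_image, Prod.fst_swap, Prod.snd_swap]
    refine h.mono.imp (fun H p hp q hq hpq => ?_) (fun H p hp q hq hpq => ?_)
    · by_contra! hlt
      have := h.injOn_snd hp hq (le_antisymm hpq (H q hq p hp hlt.le))
      exact absurd hlt (by rw [this]; exact lt_irrefl _)
    · by_contra! hlt
      have := h.injOn_snd hp hq (le_antisymm hpq (H p hp q hq hlt.le))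
      exact absurd hlt (by rw [this]; exact lt_irrefl _)

/-! ### Incidences between a Cartesian product and translates of a Sidon curve. -/

/-- The block index is the rank in `Q` divided by `g`; it is defined on all of ℝ so that
monotonicity can be used without membership in `Q`. -/
theorem exists_monotone_blocks (Q : Finset ℝ) {g : ℕ} (hg : 0 < g) :
    ∃ j : ℝ → ℕ, Monotone j ∧ (∀ q, j q ≤ Q.card / g) ∧
      ∀ k, (Q.filter fun q => j q = k).card ≤ g := by
  set r : ℝ → ℕ := fun q => (Q.filter fun q' => q' < q).card with hr
  have hmono : Monotone r := fun a b hab => Finset.card_le_card fun x hx => by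
    simp only [Finset.mem_filter] at hx ⊢
    exact ⟨hx.1, hx.2.trans_le hab⟩
  have hstrict : ∀ a ∈ Q, ∀ b, a < b → r a < r b := fun a ha b hab => by
    refine Finset.card_lt_card (Finset.ssubset_iff_of_subset ?_ |>.2 ⟨a, ?_, ?_⟩)
    · intro x hx
      simp only [Finset.mem_filter] at hx ⊢
      exact ⟨hx.1, hx.2.trans hab⟩
    · simp [ha, hab]
    · simp
  refine ⟨fun q => r q / g, fun a b hab => Nat.div_le_div_right (hmono hab),
    fun q => Nat.div_le_div_right (Finset.card_filter_le _ _), fun k => ?_⟩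
  calc (Q.filter fun q => r q / g = k).card ≤ (Finset.Ico (k * g) (k * g + g)).card := by
        refine Finset.card_le_card_of_injOn r ?_ ?_
        · intro q hq
          simp only [Finset.coe_filter, Set.mem_ofPred_eq] at hq
          simp only [Finset.coe_Ico, Set.mem_Ico]
          have h1 := Nat.div_add_mod (r q) g
          have h2 := Nat.mod_lt (r q) hg
          rw [hq.2, mul_comm] at h1
          omega
        · intro a ha b hb hab
          simp only [Finset.coe_filter, Set.mem_ofPred_eq] at ha hb
          rcases lt_trichotomy a b with h | h | h
          · exact absurd hab (hstrict a ha.1 b h).ne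
          · exact h
          · exact absurd hab (hstrict b hb.1 a h).ne'
    _ = g := by simp

theorem exists_antitone_blocks (Q : Finset ℝ) {g : ℕ} (hg : 0 < g) :
    ∃ j : ℝ → ℕ, Antitone j ∧ (∀ q, j q ≤ Q.card / g) ∧
      ∀ k, (Q.filter fun q => j q = k).card ≤ g := by
  obtain ⟨j, hj, hb, hf⟩ := exists_monotone_blocks (Q.image Neg.neg) hg
  refine ⟨fun q => j (-q), fun a b hab => hj (neg_le_neg hab), fun q => ?_, fun k => ?_⟩
  · exact (hb _).trans (Nat.div_le_div_right Finset.card_image_le)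
  · refine le_trans (Finset.card_le_card_of_injOn Neg.neg ?_ neg_injective.injOn) (hf k)
    intro q hq
    simp only [Finset.coe_filter, Set.mem_ofPred_eq] at hq
    simp [hq.1, hq.2]

/-- A fibre of size k ≥ 1 satisfies k ≤ 1 + k(k - 1). It separates occupied cells from pairs sharing
a cell. -/
theorem card_le_card_image_add_card_offDiag {α β : Type*} [DecidableEq α] [DecidableEq β]
    (T : Finset α) (φ : α → β) :
    T.card ≤ (T.image φ).card + (T.offDiag.filter fun p => φ p.1 = φ p.2).card := by
  have h1 := Finset.card_eq_sum_card_fiberwise (f := φ) (s := T) (t := T.image φ)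
    (fun x hx => by exact_mod_cast Finset.mem_image_of_mem φ hx)
  have h2 := Finset.card_eq_sum_card_fiberwise (f := fun p : α × α => φ p.1)
    (s := T.offDiag.filter fun p => φ p.1 = φ p.2) (t := T.image φ) (fun x hx => by
      have hx := Finset.mem_coe.1 hx
      simp only [Finset.mem_filter, Finset.mem_offDiag] at hx
      exact_mod_cast Finset.mem_image_of_mem φ hx.1.1)
  rw [h1, h2, Finset.card_eq_sum_ones (T.image φ), ← Finset.sum_add_distrib]
  refine Finset.sum_le_sum fun b _ => ?_
  set S := T.filter fun x => φ x = b with hS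
  have h3 : S.offDiag.card ≤
      ((T.offDiag.filter fun p => φ p.1 = φ p.2).filter fun p => φ p.1 = b).card := by
    refine Finset.card_le_card fun p hp => ?_
    simp only [hS, Finset.mem_offDiag, Finset.mem_filter] at hp ⊢
    refine ⟨⟨⟨hp.1.1, hp.2.1.1, hp.2.2⟩, hp.1.2.trans hp.2.1.2.symm⟩, hp.1.2⟩
  refine le_trans ?_ (Nat.add_le_add_left h3 1)
  rw [Finset.offDiag_card]
  rcases Nat.lt_or_ge S.card 2 with h | h
  · omega
  · have : 2 * S.card ≤ S.card * S.card := Nat.mul_le_mul_right _ h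
    omega

/-- The points of the curve which a translation by `-z` moves into `Y ×ˢ Q`. -/
noncomputable def curveHits (Γ : Finset (ℝ × ℝ)) (Y Q : Finset ℝ) (z : ℝ × ℝ) : Finset (ℝ × ℝ) :=
  Γ.filter fun p => p.1 - z.1 ∈ Y ∧ p.2 - z.2 ∈ Q

/-- Cut `Y ×ˢ Q` into cells of at most `g * h` points. A monotone curve traverses few cells, which
accounts for one point per cell; further points give pairs in a common cell, and by the Sidon
property such a pair of grid points lies on at most one translate. -/
theorem sum_card_curveHits_le_of_blocks {Γ : Finset (ℝ × ℝ)} (hΓ : IsSidonCurve Γ)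
    (Y Q : Finset ℝ) (L : Finset (ℝ × ℝ)) {g h : ℕ} {i j : ℝ → ℕ} (hi : Monotone i)
    (hib : ∀ y, i y ≤ Y.card / g) (hjb : ∀ q, j q ≤ Q.card / h)
    (hif : ∀ k, (Y.filter fun y => i y = k).card ≤ g)
    (hjf : ∀ k, (Q.filter fun q => j q = k).card ≤ h)
    (hj : ∀ p ∈ Γ, ∀ q ∈ Γ, p.1 ≤ q.1 → ∀ c, j (p.2 - c) ≤ j (q.2 - c)) :
    ∑ z ∈ L, (curveHits Γ Y Q z).card ≤
      L.card * (Y.card / g + Q.card / h + 1) + Y.card * Q.card * (g * h) := by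
  set φ : ℝ × ℝ → ℝ × ℝ → ℕ × ℕ := fun z p => (i (p.1 - z.1), j (p.2 - z.2)) with hφ
  have h1 : ∀ z, ((curveHits Γ Y Q z).image (φ z)).card ≤ Y.card / g + Q.card / h + 1 := by
    intro z
    rw [← Finset.card_range (Y.card / g + Q.card / h + 1)]
    -- The visited cells form a chain in the product order, so the sum of the two indices separates
    -- them.
    refine Finset.card_le_card_of_injOn (fun b => b.1 + b.2) ?_ ?_
    · intro b hb
      simp only [Finset.coe_image, Set.mem_image, Finset.mem_coe] at hb
      obtain ⟨p, hp, rfl⟩ := hb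
      have := hib (p.1 - z.1)
      have := hjb (p.2 - z.2)
      simp only [hφ, Finset.coe_range, Set.mem_Iio]
      omega
    · intro b hb b' hb' hbb
      simp only [Finset.coe_image, Set.mem_image, Finset.mem_coe] at hb hb'
      obtain ⟨p, hp, rfl⟩ := hb
      obtain ⟨q, hq, rfl⟩ := hb'
      have hp := (Finset.mem_filter.1 hp).1
      have hq := (Finset.mem_filter.1 hq).1
      simp only [hφ, Prod.mk.injEq] at hbb ⊢
      rcases le_total p.1 q.1 with hle | hle
      · have := hi (sub_le_sub_right hle z.1)
        have := hj p hp q hq hle z.2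
        omega
      · have := hi (sub_le_sub_right hle z.1)
        have := hj q hq p hp hle z.2
        omega
  set pairs : ℝ × ℝ → Finset ((ℝ × ℝ) × (ℝ × ℝ)) := fun z =>
    (curveHits Γ Y Q z).offDiag.filter fun p => φ z p.1 = φ z p.2 with hpairs
  have h2 : ∑ z ∈ L, (pairs z).card ≤ Y.card * Q.card * (g * h) := by
    rw [← Finset.card_sigma]
    have h3 : (L.sigma pairs).card ≤ ((Y ×ˢ Q).sigma fun w =>
        (Y.filter fun y => i y = i w.1) ×ˢ (Q.filter fun q => j q = j w.2)).card := by
      refine Finset.card_le_card_of_injOn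
        (fun s => ⟨(s.2.1.1 - s.1.1, s.2.1.2 - s.1.2), (s.2.2.1 - s.1.1, s.2.2.2 - s.1.2)⟩)
        ?_ ?_
      · rintro ⟨z, p, q⟩ hs
        simp only [hpairs, hφ, curveHits, Finset.coe_sigma, Set.mem_sigma_iff, Finset.mem_coe,
          Finset.mem_filter, Finset.mem_offDiag, Prod.mk.injEq] at hs
        simp only [Finset.coe_sigma, Set.mem_sigma_iff, Finset.mem_coe, Finset.mem_product,
          Finset.mem_filter]
        grind
      · rintro ⟨z, p, q⟩ hs ⟨z', p', q'⟩ hs' he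
        simp only [hpairs, curveHits, Finset.coe_sigma, Set.mem_sigma_iff, Finset.mem_coe,
          Finset.mem_filter, Finset.mem_offDiag] at hs hs'
        simp only [Sigma.mk.injEq, Prod.mk.injEq, heq_eq_eq] at he
        obtain ⟨⟨e1, e2⟩, e3, e4⟩ := he
        -- The two grid points determine p - q, which by the Sidon property determines p, and then
        -- the translation z.
        have hpp : p = p' := hΓ.sidon p hs.2.1.1.1 q hs.2.1.2.1.1 p' hs'.2.1.1.1 q'
          hs'.2.1.2.1.1 hs.2.1.2.2 (Prod.ext (by simp; linarith) (by simp; linarith))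
        subst hpp
        have hz : z = z' := Prod.ext (by linarith) (by linarith)
        subst hz
        have hq : q = q' := Prod.ext (by linarith) (by linarith)
        rw [hq]
    refine h3.trans ?_
    rw [Finset.card_sigma, ← Finset.card_product, ← smul_eq_mul, ← Finset.sum_const]
    refine Finset.sum_le_sum fun w _ => ?_
    rw [Finset.card_product]
    exact Nat.mul_le_mul (hif _) (hjf _)
  calc ∑ z ∈ L, (curveHits Γ Y Q z).card
      ≤ ∑ z ∈ L, ((Y.card / g + Q.card / h + 1) + (pairs z).card) :=
        Finset.sum_le_sum fun z _ =>
          (card_le_card_image_add_card_offDiag _ (φ z)).trans (Nat.add_le_add_right (h1 z) _)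
    _ ≤ _ := by
        rw [Finset.sum_add_distrib, Finset.sum_const, smul_eq_mul]
        exact Nat.add_le_add_left h2 _

theorem sum_card_curveHits_le {Γ : Finset (ℝ × ℝ)} (hΓ : IsSidonCurve Γ)
    (Y Q : Finset ℝ) (L : Finset (ℝ × ℝ)) {g h : ℕ} (hg : 0 < g) (hh : 0 < h) :
    ∑ z ∈ L, (curveHits Γ Y Q z).card ≤
      L.card * (Y.card / g + Q.card / h + 1) + Y.card * Q.card * (g * h) := by
  obtain ⟨i, hi, hib, hif⟩ := exists_monotone_blocks Y hg
  rcases hΓ.mono with hm | hm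
  · obtain ⟨j, hj, hjb, hjf⟩ := exists_monotone_blocks Q hh
    exact sum_card_curveHits_le_of_blocks hΓ Y Q L hi hib hjb hif hjf
      fun p hp q hq hpq c => hj (sub_le_sub_right (hm p hp q hq hpq) c)
  · obtain ⟨j, hj, hjb, hjf⟩ := exists_antitone_blocks Q hh
    exact sum_card_curveHits_le_of_blocks hΓ Y Q L hi hib hjb hif hjf
      fun p hp q hq hpq c => hj (sub_le_sub_right (hm p hp q hq hpq) c)

theorem card_curveHits_le_left {Γ : Finset (ℝ × ℝ)} (hΓ : IsSidonCurve Γ) (Y Q : Finset ℝ)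
    (z : ℝ × ℝ) : (curveHits Γ Y Q z).card ≤ Y.card := by
  refine Finset.card_le_card_of_injOn (fun p => p.1 - z.1) (fun p hp => ?_) ?_
  · exact (Finset.mem_filter.1 (Finset.mem_coe.1 hp)).2.1
  · intro p hp q hq hpq
    exact hΓ.injOn_fst (Finset.mem_filter.1 (Finset.mem_coe.1 hp)).1
      (Finset.mem_filter.1 (Finset.mem_coe.1 hq)).1 (sub_left_injective hpq)

theorem card_curveHits_le_right {Γ : Finset (ℝ × ℝ)} (hΓ : IsSidonCurve Γ) (Y Q : Finset ℝ)
    (z : ℝ × ℝ) : (curveHits Γ Y Q z).card ≤ Q.card := by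
  refine Finset.card_le_card_of_injOn (fun p => p.2 - z.2) (fun p hp => ?_) ?_
  · exact (Finset.mem_filter.1 (Finset.mem_coe.1 hp)).2.2
  · intro p hp q hq hpq
    exact hΓ.injOn_snd (Finset.mem_filter.1 (Finset.mem_coe.1 hp)).1
      (Finset.mem_filter.1 (Finset.mem_coe.1 hq)).1 (sub_left_injective hpq)

/-- The Szemerédi–Trotter bound for a Cartesian product and translates of a curve. -/
theorem szemerediTrotter_curveHits {Γ : Finset (ℝ × ℝ)} (hΓ : IsSidonCurve Γ)
    (Y Q : Finset ℝ) (L : Finset (ℝ × ℝ)) {I : ℝ}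
    (hI : I = ∑ z ∈ L, ((curveHits Γ Y Q z).card : ℝ)) :
    I < 4 * L.card ∨ I ^ 3 ≤ 100 * Y.card ^ 2 * Q.card ^ 2 * L.card ^ 2 := by
  by_cases hlt : I < 4 * L.card
  · exact Or.inl hlt
  right
  push Not at hlt
  rcases L.eq_empty_or_nonempty with rfl | hL
  · simp [hI]
  have hl : (0 : ℝ) < L.card := by exact_mod_cast hL.card_pos
  have hI0 : 0 < I := by linarith
  have hIY : I ≤ L.card * Y.card := by
    rw [hI, ← nsmul_eq_mul]
    exact Finset.sum_le_card_nsmul _ _ _ fun z _ => by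
      exact_mod_cast card_curveHits_le_left hΓ Y Q z
  have hIQ : I ≤ L.card * Q.card := by
    rw [hI, ← nsmul_eq_mul]
    exact Finset.sum_le_card_nsmul _ _ _ fun z _ => by
      exact_mod_cast card_curveHits_le_right hΓ Y Q z
  have hY : (0 : ℝ) < Y.card := by
    by_contra! h
    nlinarith
  have hQ : (0 : ℝ) < Q.card := by
    by_contra! h
    nlinarith
  have key : ∀ y : ℝ, 0 < y → I ≤ L.card * y → ∃ g : ℕ, 0 < g ∧
      L.card * (y / g) ≤ I / 4 ∧ (g : ℝ) ≤ 5 * y * L.card / I := by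
    intro y hy hIy
    -- This block size makes each cell term at most I/4. Rounding up costs at most yL/I, which is ≥
    -- 1 by the trivial bound I ≤ Ly.
    refine ⟨⌈4 * y * L.card / I⌉₊, Nat.ceil_pos.2 (by positivity), ?_, ?_⟩
    · have hg := Nat.le_ceil (4 * y * L.card / I)
      set g : ℝ := (⌈4 * y * L.card / I⌉₊ : ℝ)
      have hg0 : 0 < g := lt_of_lt_of_le (by positivity) hg
      rw [div_le_iff₀ hI0] at hg
      rw [← mul_div_assoc, div_le_iff₀ hg0]
      linarith
    · have hg := (Nat.ceil_lt_add_one (a := 4 * y * L.card / I) (by positivity)).le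
      refine hg.trans ?_
      have : 1 ≤ y * L.card / I := by
        rw [le_div_iff₀ hI0]
        linarith
      calc 4 * y * L.card / I + 1 ≤ 4 * y * L.card / I + y * L.card / I := by gcongr
        _ = _ := by ring
  obtain ⟨g, hg, hg1, hg2⟩ := key _ hY hIY
  obtain ⟨h, hh, hh1, hh2⟩ := key _ hQ hIQ
  have hmain : I ≤ L.card * (Y.card / g + Q.card / h + 1) + Y.card * Q.card * (g * h) := by
    have h1 : (∑ z ∈ L, ((curveHits Γ Y Q z).card : ℝ)) ≤
        L.card * (((Y.card / g : ℕ) : ℝ) + ((Q.card / h : ℕ) : ℝ) + 1)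
          + Y.card * Q.card * (g * h) := by
      exact_mod_cast sum_card_curveHits_le hΓ Y Q L hg hh
    rw [hI]
    refine h1.trans ?_
    gcongr
    · exact Nat.cast_div_le
    · exact Nat.cast_div_le
  -- The two cell terms and the term `L.card` (as I ≥ 4|L|) absorb 3I/4.
  have h4 : I / 4 ≤ Y.card * Q.card * (g * h) := by linarith
  have h5 : I / 4 ≤ Y.card * Q.card *
      ((5 * Y.card * L.card / I) * (5 * Q.card * L.card / I)) := by
    refine h4.trans ?_
    gcongr
  have h6 : (Y.card : ℝ) * Q.card * ((5 * Y.card * L.card / I) * (5 * Q.card * L.card / I))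
      = (25 * Y.card ^ 2 * Q.card ^ 2 * L.card ^ 2) / I ^ 2 := by
    field_simp
    norm_num
  rw [h6, le_div_iff₀ (by positivity)] at h5
  nlinarith

/-! ### Representation counts and third-order energy. -/

theorem diffRep_eq_left (A B : Finset ℝ) (y : ℝ) :
    diffRep A B y = (A.filter fun a => a - y ∈ B).card := by
  refine Finset.card_nbij' (fun p => p.1) (fun a => (a, a - y)) ?_ ?_ ?_ ?_
  · rintro ⟨a, b⟩ h
    simp only [Finset.coe_filter, Finset.mem_product, Set.mem_ofPred_eq] at h ⊢
    refine ⟨h.1.1, ?_⟩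
    rw [← h.2, sub_sub_cancel]
    exact h.1.2
  · intro a h
    simp only [Finset.coe_filter, Finset.mem_product, Set.mem_ofPred_eq] at h ⊢
    exact ⟨h, by ring⟩
  · rintro ⟨a, b⟩ h
    simp only [Finset.coe_filter, Finset.mem_product, Set.mem_ofPred_eq] at h
    simp [← h.2]
  · intro a _
    rfl

theorem diffRep_neg (A B : Finset ℝ) (y : ℝ) : diffRep B A (-y) = diffRep A B y := by
  refine Finset.card_nbij' Prod.swap Prod.swap ?_ ?_ (fun _ _ => rfl) (fun _ _ => rfl)
  · rintro ⟨a, b⟩ h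
    simp only [Finset.coe_filter, Finset.mem_product, Set.mem_ofPred_eq, Prod.swap_prod_mk] at h ⊢
    exact ⟨⟨h.1.2, h.1.1⟩, by linarith⟩
  · rintro ⟨a, b⟩ h
    simp only [Finset.coe_filter, Finset.mem_product, Set.mem_ofPred_eq, Prod.swap_prod_mk] at h ⊢
    exact ⟨⟨h.1.2, h.1.1⟩, by linarith⟩

theorem diffRep_le_card_left (A B : Finset ℝ) (y : ℝ) : diffRep A B y ≤ A.card := by
  rw [diffRep_eq_left]
  exact Finset.card_filter_le _ _

theorem diffRep_le_card_right (A B : Finset ℝ) (y : ℝ) : diffRep A B y ≤ B.card := by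
  rw [← diffRep_neg]
  exact diffRep_le_card_left _ _ _

theorem diffRep_mono {A A' B B' : Finset ℝ} (hA : A ⊆ A') (hB : B ⊆ B') (y : ℝ) :
    diffRep A B y ≤ diffRep A' B' y :=
  Finset.card_le_card (Finset.filter_subset_filter _ (Finset.product_subset_product hA hB))

theorem diffRep_pos_iff {A B : Finset ℝ} {y : ℝ} : 0 < diffRep A B y ↔ y ∈ A - B := by
  simp only [diffRep, Finset.card_pos, Finset.Nonempty, Finset.mem_filter, Finset.mem_product,
    Prod.exists, Finset.mem_sub]
  constructor
  · rintro ⟨a, b, ⟨ha, hb⟩, h⟩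
    exact ⟨a, ha, b, hb, h⟩
  · rintro ⟨a, ha, b, hb, h⟩
    exact ⟨a, b, ⟨ha, hb⟩, h⟩

theorem diffRep_eq_zero {A B : Finset ℝ} {y : ℝ} (h : y ∉ A - B) : diffRep A B y = 0 := by
  by_contra h0
  exact h (diffRep_pos_iff.1 (Nat.pos_of_ne_zero h0))

theorem sum_diffRep_mul (A B Y : Finset ℝ) (w : ℝ → ℝ) :
    ∑ y ∈ Y, (diffRep A B y : ℝ) * w y =
      ∑ p ∈ (A ×ˢ B).filter (fun p => p.1 - p.2 ∈ Y), w (p.1 - p.2) := by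
  rw [← Finset.sum_fiberwise_of_maps_to' (t := Y) (g := fun p : ℝ × ℝ => p.1 - p.2)
    (fun p hp => (Finset.mem_filter.1 hp).2)]
  refine Finset.sum_congr rfl fun y hy => ?_
  rw [Finset.sum_const, nsmul_eq_mul, Finset.filter_filter, diffRep]
  congr 3
  ext p
  simp only [Finset.mem_filter]
  constructor
  · rintro ⟨h, rfl⟩
    exact ⟨h, hy, rfl⟩
  · rintro ⟨h, _, h'⟩
    exact ⟨h, h'⟩

theorem sum_diffRep (A B Y : Finset ℝ) :
    ∑ y ∈ Y, (diffRep A B y : ℝ) = ((A ×ˢ B).filter (fun p => p.1 - p.2 ∈ Y)).card := by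
  simpa using sum_diffRep_mul A B Y (fun _ => 1)

theorem sum_diffRep_sub_mul (A B : Finset ℝ) (w : ℝ → ℝ) :
    ∑ y ∈ A - B, (diffRep A B y : ℝ) * w y = ∑ a ∈ A, ∑ b ∈ B, w (a - b) := by
  rw [sum_diffRep_mul, Finset.filter_true_of_mem, Finset.sum_product]
  intro p hp
  rw [Finset.mem_product] at hp
  exact Finset.sub_mem_sub hp.1 hp.2

/-- The third-order additive energy of `A`. -/
noncomputable def energyThree (A : Finset ℝ) : ℝ := ∑ x ∈ A - A, (diffRep A A x : ℝ) ^ 3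

theorem energyThree_eq_sum (A : Finset ℝ) :
    energyThree A = ∑ a ∈ A, ∑ a' ∈ A, (diffRep A A (a - a') : ℝ) ^ 2 := by
  rw [energyThree, ← sum_diffRep_sub_mul A A fun x => (diffRep A A x : ℝ) ^ 2]
  exact Finset.sum_congr rfl fun x _ => by ring

theorem sum_cube_le_energyThree (A Y : Finset ℝ) :
    ∑ y ∈ Y, (diffRep A A y : ℝ) ^ 3 ≤ energyThree A := by
  rw [energyThree, ← Finset.sum_filter_add_sum_filter_not Y (fun y => y ∈ A - A)]
  rw [Finset.sum_eq_zero (s := Y.filter fun y => y ∉ A - A), add_zero]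
  · exact Finset.sum_le_sum_of_subset_of_nonneg (fun y hy => (Finset.mem_filter.1 hy).2)
      fun _ _ _ => by positivity
  · intro y hy
    rw [diffRep_eq_zero (Finset.mem_filter.1 hy).2]
    simp

theorem energyThree_nonneg (A : Finset ℝ) : 0 ≤ energyThree A :=
  Finset.sum_nonneg fun _ _ => by positivity

theorem energyThree_mono {A B : Finset ℝ} (h : A ⊆ B) : energyThree A ≤ energyThree B :=
  le_trans (Finset.sum_le_sum fun x _ => by
    have : (diffRep A A x : ℝ) ≤ diffRep B B x := by exact_mod_cast diffRep_mono h h x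
    gcongr) (sum_cube_le_energyThree B (A - A))

theorem card_pow_three_le_energyThree (A : Finset ℝ) : (A.card : ℝ) ^ 3 ≤ energyThree A := by
  have h := sum_cube_le_energyThree A {0}
  rw [Finset.sum_singleton, diffRep_eq_left] at h
  simpa using h

theorem energyThree_le_card_pow_four (A : Finset ℝ) : energyThree A ≤ (A.card : ℝ) ^ 4 := by
  rw [energyThree_eq_sum]
  calc ∑ a ∈ A, ∑ a' ∈ A, (diffRep A A (a - a') : ℝ) ^ 2
      ≤ ∑ a ∈ A, ∑ a' ∈ A, (A.card : ℝ) ^ 2 := by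
        refine Finset.sum_le_sum fun a _ => Finset.sum_le_sum fun a' _ => ?_
        have : (diffRep A A (a - a') : ℝ) ≤ A.card := by
          exact_mod_cast diffRep_le_card_left A A _
        gcongr
    _ = _ := by
        simp only [Finset.sum_const, nsmul_eq_mul]
        ring

/-! ### Third-moment bounds from incidences. -/

/-- The third moment of the number of representations in `A - X` is at most `D * |X| ^ 2`. -/
def CubeBound (A : Finset ℝ) (D : ℝ) : Prop :=
  ∀ X Y : Finset ℝ, ∑ y ∈ Y, (diffRep A X y : ℝ) ^ 3 ≤ D * (X.card : ℝ) ^ 2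

theorem CubeBound.subset {A B : Finset ℝ} {D : ℝ} (h : CubeBound B D) (hAB : A ⊆ B) :
    CubeBound A D := fun X Y => le_trans (Finset.sum_le_sum fun y _ => by
      have : (diffRep A X y : ℝ) ≤ diffRep B X y := by
        exact_mod_cast diffRep_mono hAB subset_rfl y
      gcongr) (h X Y)

/-- Translates are indexed by `X ×ˢ C` and tested against `Y ×ˢ Q`. For a fixed p in Γ the hits
factor into a choice of x and a choice of c, so there are at least |Y|tR incidences. -/
theorem card_mul_pow_three_le_of_rich {Γ : Finset (ℝ × ℝ)} (hΓ : IsSidonCurve Γ)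
    (X Y C Q : Finset ℝ) {t R : ℝ} (ht0 : 0 < t) (hR0 : 0 < R)
    (ht : ∀ y ∈ Y, t ≤ diffRep (Γ.image Prod.fst) X y)
    (hR : ∀ p ∈ Γ, R ≤ (C.filter fun c => p.2 - c ∈ Q).card) (hQ : Γ.card ≤ Q.card) :
    Y.card * t ^ 3 * R ^ 3 ≤ 100 * Q.card ^ 2 * X.card ^ 2 * C.card ^ 2 := by
  rcases Y.eq_empty_or_nonempty with rfl | ⟨y, hy⟩
  · simp only [Finset.card_empty, Nat.cast_zero, zero_mul]
    positivity
  have hcard : (Γ.image Prod.fst).card = Γ.card := Finset.card_image_of_injOn hΓ.injOn_fst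
  have htX : t ≤ X.card := (ht y hy).trans (by exact_mod_cast diffRep_le_card_right _ _ _)
  have htQ : t ≤ Q.card := (ht y hy).trans (by
    exact_mod_cast (diffRep_le_card_left _ _ _).trans (hcard.le.trans hQ))
  have hne : Γ.Nonempty := by
    rw [Finset.nonempty_iff_ne_empty]
    rintro rfl
    have := ht y hy
    simp [diffRep] at this
    linarith
  obtain ⟨p, hp⟩ := hne
  have hRC : R ≤ C.card := (hR p hp).trans (by exact_mod_cast Finset.card_filter_le _ _)
  have hRQ : R ≤ Q.card := (hR p hp).trans (by
    exact_mod_cast Finset.card_le_card_of_injOn (fun c => p.2 - c)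
      (fun c hc => (Finset.mem_filter.1 (Finset.mem_coe.1 hc)).2)
      (sub_right_injective.injOn))
  set I : ℝ := ∑ z ∈ X ×ˢ C, ((curveHits Γ Y Q z).card : ℝ) with hI
  have hIlow : Y.card * t * R ≤ I := by
    have h1 : I = ∑ p ∈ Γ, (((X.filter fun x => p.1 - x ∈ Y).card : ℝ) *
        (C.filter fun c => p.2 - c ∈ Q).card) := by
      simp only [hI, curveHits]
      have := Finset.sum_card_bipartiteAbove_eq_sum_card_bipartiteBelow (s := X ×ˢ C) (t := Γ)
        (fun z p => p.1 - z.1 ∈ Y ∧ p.2 - z.2 ∈ Q)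
      simp only [Finset.bipartiteAbove, Finset.bipartiteBelow] at this
      have h2 : ∀ p : ℝ × ℝ, ((X ×ˢ C).filter fun z => p.1 - z.1 ∈ Y ∧ p.2 - z.2 ∈ Q)
          = (X.filter fun x => p.1 - x ∈ Y) ×ˢ (C.filter fun c => p.2 - c ∈ Q) := fun p =>
        (Finset.filter_product (fun x => p.1 - x ∈ Y) (fun c => p.2 - c ∈ Q))
      simp only [h2, Finset.card_product] at this
      exact_mod_cast this
    have h3 : ∑ y ∈ Y, (diffRep (Γ.image Prod.fst) X y : ℝ) =
        ∑ p ∈ Γ, ((X.filter fun x => p.1 - x ∈ Y).card : ℝ) := by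
      rw [sum_diffRep, Finset.card_filter, Finset.sum_product,
        Finset.sum_image hΓ.injOn_fst]
      push_cast
      refine Finset.sum_congr rfl fun p _ => ?_
      simp
    calc Y.card * t * R ≤ (∑ y ∈ Y, (diffRep (Γ.image Prod.fst) X y : ℝ)) * R := by
          gcongr
          rw [← nsmul_eq_mul]
          exact Finset.card_nsmul_le_sum _ _ _ ht
      _ ≤ I := by
          rw [h1, h3, Finset.sum_mul]
          exact Finset.sum_le_sum fun p hp => by
            have := hR p hp
            gcongr
  have hL : (((X ×ˢ C).card : ℕ) : ℝ) = X.card * C.card := by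
    rw [Finset.card_product]
    push_cast
    rfl
  have hYpos : (0 : ℝ) < Y.card := by exact_mod_cast Finset.card_pos.2 ⟨y, hy⟩
  rcases szemerediTrotter_curveHits hΓ Y Q (X ×ˢ C) hI with h | h
  · rw [hL] at h
    calc Y.card * t ^ 3 * R ^ 3 = (Y.card * t * R) * (t * t) * (R * R) := by ring
      -- When translates dominate the incidence bound, the trivial bounds t ≤ min(|X|, |Q|) and R ≤
      -- min(|C|, |Q|) suffice.
      _ ≤ (4 * (X.card * C.card)) * (X.card * Q.card) * (C.card * Q.card) := by
          have := hIlow.trans h.le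
          gcongr
      _ ≤ _ := by
          have : (0 : ℝ) ≤ (Q.card : ℝ) ^ 2 * X.card ^ 2 * C.card ^ 2 := by positivity
          nlinarith
  · rw [hL] at h
    have h4 : (Y.card * t * R) ^ 3 ≤ I ^ 3 := by gcongr
    have h5 := h4.trans h
    have h6 : (Y.card : ℝ) ^ 2 * (Y.card * t ^ 3 * R ^ 3) ≤
        (Y.card : ℝ) ^ 2 * (100 * Q.card ^ 2 * X.card ^ 2 * C.card ^ 2) := by
      calc _ = (Y.card * t * R) ^ 3 := by ring
        _ ≤ _ := h5
        _ = _ := by ring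
    exact le_of_mul_le_mul_left h6 (by positivity)

theorem sum_pow_three_le_of_level_bound {ι : Type*} (s : Finset ι) (f : ι → ℕ) {n : ℕ}
    (hf : ∀ x ∈ s, f x ≤ n) {M : ℝ}
    (h : ∀ t : ℕ, 0 < t → ((s.filter fun x => t ≤ f x).card : ℝ) * (t : ℝ) ^ 3 ≤ M) :
    ∑ x ∈ s, (f x : ℝ) ^ 3 ≤ 8 * (Nat.log 2 n + 1 : ℕ) * M := by
  have h0 : ∑ x ∈ s, (f x : ℝ) ^ 3 = ∑ x ∈ s.filter (fun x => f x ≠ 0), (f x : ℝ) ^ 3 := by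
    rw [Finset.sum_filter_of_ne]
    intro x _ hx h0
    simp [h0] at hx
  rw [h0, ← Finset.sum_fiberwise_of_maps_to (t := Finset.range (Nat.log 2 n + 1))
    (g := fun x => Nat.log 2 (f x)) (fun x hx => Finset.mem_range.2 (Nat.lt_succ_of_le
      (Nat.log_mono_right (hf x (Finset.mem_filter.1 hx).1))))]
  calc _ ≤ ∑ j ∈ Finset.range (Nat.log 2 n + 1), 8 * M := by
        refine Finset.sum_le_sum fun j _ => ?_
        calc _ ≤ ∑ x ∈ s.filter (fun x => 2 ^ j ≤ f x), 8 * ((2 ^ j : ℕ) : ℝ) ^ 3 := by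
              refine (Finset.sum_le_sum (g := fun _ => 8 * ((2 ^ j : ℕ) : ℝ) ^ 3)
                fun x hx => ?_).trans
                (Finset.sum_le_sum_of_subset_of_nonneg ?_ fun _ _ _ => by positivity)
              · have hlt := Nat.lt_pow_succ_log_self (b := 2) (by norm_num) (f x)
                rw [(Finset.mem_filter.1 hx).2] at hlt
                have : (f x : ℝ) ≤ 2 * (2 ^ j : ℕ) := by
                  exact_mod_cast hlt.le.trans (by rw [pow_succ, mul_comm])
                calc (f x : ℝ) ^ 3 ≤ (2 * (2 ^ j : ℕ)) ^ 3 := by gcongr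
                  _ = _ := by ring
              · intro x hx
                simp only [Finset.mem_filter] at hx ⊢
                refine ⟨hx.1.1, ?_⟩
                rw [← hx.2]
                exact Nat.pow_log_le_self 2 hx.1.2
          _ = 8 * (((s.filter fun x => 2 ^ j ≤ f x).card : ℝ) * ((2 ^ j : ℕ) : ℝ) ^ 3) := by
              rw [Finset.sum_const, nsmul_eq_mul]
              ring
          _ ≤ 8 * M := by
              have := h (2 ^ j) (by positivity)
              gcongr
    _ = _ := by
        rw [Finset.sum_const, Finset.card_range, nsmul_eq_mul]
        ring

/-! ### Pruning to a subset with uniformly distributed third energy. -/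

/-- The contribution of `a` to the third-order energy of `A`. -/
noncomputable def energyAt (A : Finset ℝ) (a : ℝ) : ℝ :=
  ∑ a' ∈ A, (diffRep A A (a - a') : ℝ) ^ 2

/-- If fewer than a proportion δ of the points carry a quarter of the average energy, discard them:
the rest has at most a quarter of the energy. As a nonempty set has third energy at least 1, this
happens at most k times. -/
theorem exists_subset_many_energyAt_large {δ : ℝ} (hδ0 : 0 < δ) (hδ1 : δ < 1) (k : ℕ) :
    ∀ A : Finset ℝ, A.Nonempty → energyThree A ≤ 2 ^ k → ∃ A₁ ⊆ A, A₁.Nonempty ∧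
      (1 - δ) ^ k * A.card ≤ A₁.card ∧
      δ * A₁.card ≤
        (A₁.filter fun a => energyThree A₁ ≤ 4 * A₁.card * energyAt A₁ a).card := by
  have step : ∀ A : Finset ℝ, A.Nonempty →
      δ * A.card ≤ (A.filter fun a => energyThree A ≤ 4 * A.card * energyAt A a).card ∨
      ∃ B ⊆ A, B.Nonempty ∧ (1 - δ) * A.card ≤ B.card ∧ 4 * energyThree B ≤ energyThree A := by
    intro A hA
    rw [or_iff_not_imp_left]
    intro hlt
    push Not at hlt
    have hA0 : (0 : ℝ) < A.card := by exact_mod_cast hA.card_pos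
    have hsum : ((A.filter fun a => energyThree A ≤ 4 * A.card * energyAt A a).card : ℝ) +
        (A.filter fun a => ¬ energyThree A ≤ 4 * A.card * energyAt A a).card = A.card := by
      exact_mod_cast Finset.card_filter_add_card_filter_not _
    set B := A.filter fun a => ¬ energyThree A ≤ 4 * A.card * energyAt A a with hB
    have hBA : B ⊆ A := Finset.filter_subset _ _
    have hBc : (1 - δ) * A.card ≤ B.card := by linarith
    refine ⟨B, hBA, ?_, hBc, ?_⟩
    · rw [← Finset.card_pos]
      have : (0 : ℝ) < B.card := lt_of_lt_of_le (mul_pos (by linarith) hA0) hBc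
      exact_mod_cast this
    · have h1 : energyThree B ≤ ∑ a ∈ B, energyAt A a := by
        rw [energyThree_eq_sum]
        refine Finset.sum_le_sum fun a _ => ?_
        refine (Finset.sum_le_sum fun a' _ => ?_).trans
          (Finset.sum_le_sum_of_subset_of_nonneg hBA fun _ _ _ => by positivity)
        have : (diffRep B B (a - a') : ℝ) ≤ diffRep A A (a - a') := by
          exact_mod_cast diffRep_mono hBA hBA _
        gcongr
      have h2 : (4 * A.card) * ∑ a ∈ B, energyAt A a ≤ A.card * energyThree A := by
        rw [Finset.mul_sum]
        calc _ ≤ ∑ a ∈ B, energyThree A := Finset.sum_le_sum fun a ha => by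
              have := (Finset.mem_filter.1 ha).2
              push Not at this
              exact this.le
          _ = B.card * energyThree A := by rw [Finset.sum_const, nsmul_eq_mul]
          _ ≤ _ := by
              have : (B.card : ℝ) ≤ A.card := by exact_mod_cast Finset.card_le_card hBA
              have := energyThree_nonneg A
              gcongr
      have h3 : (A.card : ℝ) * (4 * energyThree B) ≤ A.card * energyThree A := by
        refine le_trans ?_ h2
        have := mul_le_mul_of_nonneg_left h1 (by positivity : (0 : ℝ) ≤ 4 * A.card)
        linarith
      exact le_of_mul_le_mul_left h3 hA0
  induction k with
  | zero =>
    intro A hA hE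
    rcases step A hA with h | ⟨B, _, hB, _, hBE⟩
    · exact ⟨A, subset_rfl, hA, by simp, h⟩
    · exfalso
      have h1 := card_pow_three_le_energyThree B
      have h2 : (1 : ℝ) ≤ B.card := by exact_mod_cast hB.card_pos
      have h3 : (1 : ℝ) ≤ (B.card : ℝ) ^ 3 := one_le_pow₀ h2
      rw [pow_zero] at hE
      linarith
  | succ k ih =>
    intro A hA hE
    rcases step A hA with h | ⟨B, hBA, hB, hBc, hBE⟩
    · refine ⟨A, subset_rfl, hA, ?_, h⟩
      have : (1 - δ) ^ (k + 1) ≤ 1 := pow_le_one₀ (by linarith) (by linarith)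
      have h0 : (0 : ℝ) ≤ A.card := by positivity
      nlinarith
    · have h2k : (0 : ℝ) < 2 ^ k := by positivity
      obtain ⟨A₁, h1, h2, h3, h4⟩ := ih B hB (by rw [pow_succ] at hE; linarith)
      refine ⟨A₁, h1.trans hBA, h2, le_trans ?_ h3, h4⟩
      rw [pow_succ, mul_assoc]
      have : 0 ≤ (1 - δ) ^ k := pow_nonneg (by linarith) _
      gcongr

theorem exists_level {ι : Type*} (s : Finset ι) (f : ι → ℕ) {n : ℕ} (hf : ∀ x ∈ s, f x ≤ n)
    (w : ι → ℝ) : ∃ j : ℕ, ∑ x ∈ s, w x ≤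
      (Nat.log 2 n + 1 : ℕ) * ∑ x ∈ s.filter (fun x => Nat.log 2 (f x) = j), w x := by
  obtain ⟨j, -, hj⟩ := Finset.exists_le_sum_fiber_of_maps_to_of_nsmul_le_sum
    (s := s) (t := Finset.range (Nat.log 2 n + 1)) (f := fun x => Nat.log 2 (f x)) (w := w)
    (b := (∑ x ∈ s, w x) / (Nat.log 2 n + 1 : ℕ))
    (fun x hx => Finset.mem_range.2 (Nat.lt_succ_of_le (Nat.log_mono_right (hf x hx))))
    ⟨0, by simp⟩ (by
      rw [Finset.card_range, nsmul_eq_mul, mul_div_cancel₀]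
      positivity)
  refine ⟨j, ?_⟩
  rwa [div_le_iff₀ (by positivity), mul_comm] at hj

theorem sum_sq_level_le {ι : Type*} (s : Finset ι) (f : ι → ℕ) (j : ℕ) :
    ∑ x ∈ s.filter (fun x => Nat.log 2 (f x) = j), (f x : ℝ) ^ 2 ≤
      (s.filter fun x => Nat.log 2 (f x) = j).card * (4 * ((2 : ℝ) ^ j) ^ 2) := by
  rw [← nsmul_eq_mul]
  refine Finset.sum_le_card_nsmul _ _ _ fun x hx => ?_
  have hlt := Nat.lt_pow_succ_log_self (b := 2) (by norm_num) (f x)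
  rw [(Finset.mem_filter.1 hx).2] at hlt
  have : (f x : ℝ) ≤ 2 * 2 ^ j := by
    exact_mod_cast hlt.le.trans (by rw [pow_succ, mul_comm])
  calc (f x : ℝ) ^ 2 ≤ (2 * 2 ^ j) ^ 2 := by gcongr
    _ = _ := by ring

/-- The differences of `A` whose number of representations lies in `[2 ^ j, 2 ^ (j + 1))`. -/
noncomputable def levelSet (A : Finset ℝ) (j : ℕ) : Finset ℝ :=
  (A - A).filter fun x => Nat.log 2 (diffRep A A x) = j

theorem two_pow_le_diffRep_of_mem_levelSet {A : Finset ℝ} {j : ℕ} {x : ℝ}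
    (hx : x ∈ levelSet A j) : (2 : ℝ) ^ j ≤ diffRep A A x := by
  obtain ⟨h1, h2⟩ := Finset.mem_filter.1 hx
  rw [← h2]
  exact_mod_cast Nat.pow_log_le_self 2 (diffRep_pos_iff.2 h1).ne'

theorem card_levelSet_mul_le (A : Finset ℝ) (j : ℕ) :
    ((levelSet A j).card : ℝ) * ((2 : ℝ) ^ j) ^ 3 ≤ energyThree A := by
  refine le_trans ?_ (sum_cube_le_energyThree A (levelSet A j))
  rw [← nsmul_eq_mul]
  refine Finset.card_nsmul_le_sum _ _ _ fun x hx => ?_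
  have := two_pow_le_diffRep_of_mem_levelSet hx
  gcongr

theorem card_filter_log_le_levelSet (A : Finset ℝ) {a : ℝ} (ha : a ∈ A) (j : ℕ) :
    (A.filter fun a' => Nat.log 2 (diffRep A A (a - a')) = j).card ≤
      ((levelSet A j).filter fun c => a - c ∈ A).card := by
  refine Finset.card_le_card_of_injOn (fun a' => a - a') (fun a' ha' => ?_)
    sub_right_injective.injOn
  have ha' := Finset.mem_filter.1 (Finset.mem_coe.1 ha')
  rw [Finset.mem_coe, Finset.mem_filter, levelSet, Finset.mem_filter]
  exact ⟨⟨Finset.sub_mem_sub ha ha'.1, ha'.2⟩, by rw [sub_sub_cancel]; exact ha'.1⟩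

/-- After pruning, pigeonhole twice: each good a has a dyadic level carrying a 1/l share of its
energy, and a 1/l share of the good points agree on that level. -/
theorem exists_subset_same_level (A : Finset ℝ) (hA : A.Nonempty) {n : ℕ} (hn : A.card ≤ n) :
    ∃ A₁ ⊆ A, ∃ A₂ ⊆ A₁, ∃ j : ℕ, A₁.Nonempty ∧
      (A.card : ℝ) ≤ 16 * (Nat.log 2 n + 1 : ℕ) ^ 2 * A₂.card ∧
      ∀ a ∈ A₂, energyThree A₁ ≤ 16 * A₁.card * (Nat.log 2 n + 1 : ℕ) * ((2 : ℝ) ^ j) ^ 2 *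
        ((levelSet A₁ j).filter fun c => a - c ∈ A₁).card := by
  set l : ℕ := Nat.log 2 n + 1 with hl
  have hl1 : (1 : ℝ) ≤ l := by exact_mod_cast Nat.succ_le_succ (Nat.zero_le _)
  have hδ0 : (0 : ℝ) < 1 / (8 * l) := by positivity
  -- With δ = 1/(8l) and 4l rounds, Bernoulli's inequality keeps at least half of `A`.
  have hδ1 : (1 : ℝ) / (8 * l) ≤ 1 / 8 := by
    rw [div_le_div_iff_of_pos_left] <;> linarith
  have hE : energyThree A ≤ 2 ^ (4 * l) := by
    refine (energyThree_le_card_pow_four A).trans ?_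
    have : (A.card : ℝ) ≤ 2 ^ l := by
      exact_mod_cast hn.trans (Nat.lt_pow_succ_log_self (by norm_num) n).le
    calc (A.card : ℝ) ^ 4 ≤ (2 ^ l) ^ 4 := by gcongr
      _ = _ := by rw [← pow_mul, mul_comm]
  obtain ⟨A₁, hA₁, hne, hcard, hgood⟩ :=
    exists_subset_many_energyAt_large hδ0 (by linarith) (4 * l) A hA hE
  have hbern := one_add_mul_le_pow (a := -(1 / (8 * (l : ℝ)))) (by linarith) (4 * l)
  have hhalf : (A.card : ℝ) ≤ 2 * A₁.card := by
    have h1 : (1 : ℝ) / 2 ≤ (1 - 1 / (8 * l)) ^ (4 * l) := by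
      rw [← sub_eq_add_neg] at hbern
      refine le_trans (le_of_eq ?_) hbern
      push_cast
      field_simp
      norm_num
    have h2 : (1 : ℝ) / 2 * A.card ≤ (1 - 1 / (8 * l)) ^ (4 * l) * A.card := by gcongr
    linarith
  set G := A₁.filter fun a => energyThree A₁ ≤ 4 * A₁.card * energyAt A₁ a with hG
  have hlev : ∀ a, ∃ j : ℕ, energyAt A₁ a ≤ l *
      ∑ a' ∈ A₁.filter (fun a' => Nat.log 2 (diffRep A₁ A₁ (a - a')) = j),
        (diffRep A₁ A₁ (a - a') : ℝ) ^ 2 := fun a =>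
    exists_level A₁ (fun a' => diffRep A₁ A₁ (a - a')) (fun a' _ =>
      (diffRep_le_card_left _ _ _).trans ((Finset.card_le_card hA₁).trans hn)) _
  choose J hJ using hlev
  -- `exists_level` does not bound its level; a level above log₂ n would be an empty class and force
  -- zero energy.
  have hJn : ∀ a ∈ G, J a ≤ Nat.log 2 n ∨ energyThree A₁ ≤ 0 := by
    intro a ha
    by_contra! hcon
    have hempty : A₁.filter (fun a' => Nat.log 2 (diffRep A₁ A₁ (a - a')) = J a) = ∅ := by
      refine Finset.filter_false_of_mem fun a' _ h => ?_
      have := Nat.log_mono_right (b := 2) ((diffRep_le_card_left A₁ A₁ (a - a')).trans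
        ((Finset.card_le_card hA₁).trans hn))
      omega
    have h1 := hJ a
    rw [hempty, Finset.sum_empty, mul_zero] at h1
    have h2 := (Finset.mem_filter.1 ha).2
    have h3 : (0 : ℝ) ≤ 4 * A₁.card := by positivity
    nlinarith
  have hEpos : 0 < energyThree A₁ := by
    refine lt_of_lt_of_le ?_ (card_pow_three_le_energyThree A₁)
    have : (0 : ℝ) < A₁.card := by exact_mod_cast hne.card_pos
    positivity
  obtain ⟨j, -, hj⟩ := Finset.exists_le_sum_fiber_of_maps_to_of_nsmul_le_sum
    (s := G) (t := Finset.range l) (f := J) (w := fun _ => (1 : ℝ)) (b := G.card / (l : ℝ))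
    (fun a ha => Finset.mem_range.2 (Nat.lt_succ_of_le ((hJn a ha).resolve_right hEpos.not_ge)))
    ⟨0, by simp [hl]⟩ (by
      rw [Finset.card_range, nsmul_eq_mul, mul_div_cancel₀ _ (by positivity)]
      simp)
  rw [div_le_iff₀ (by positivity), Finset.sum_const, nsmul_eq_mul, mul_one] at hj
  refine ⟨A₁, hA₁, G.filter fun a => J a = j, (Finset.filter_subset _ _).trans
    (Finset.filter_subset _ _), j, hne, ?_, ?_⟩
  · have h1 : (A₁.card : ℝ) ≤ 8 * l * G.card := by
      rw [one_div, inv_mul_le_iff₀ (by positivity)] at hgood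
      exact hgood
    calc (A.card : ℝ) ≤ 2 * (8 * l * G.card) := by linarith
      _ ≤ 2 * (8 * l * ((G.filter fun a => J a = j).card * l)) := by gcongr
      _ = _ := by ring
  · intro a ha
    obtain ⟨haG, haj⟩ := Finset.mem_filter.1 ha
    obtain ⟨haA, hae⟩ := Finset.mem_filter.1 haG
    have h1 := hJ a
    rw [haj] at h1
    have h2 := h1.trans (mul_le_mul_of_nonneg_left
      (sum_sq_level_le A₁ (fun a' => diffRep A₁ A₁ (a - a')) j) (by positivity))
    have h3 : ((A₁.filter fun a' => Nat.log 2 (diffRep A₁ A₁ (a - a')) = j).card : ℝ) ≤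
        ((levelSet A₁ j).filter fun c => a - c ∈ A₁).card := by
      exact_mod_cast card_filter_log_le_levelSet A₁ haA j
    calc energyThree A₁ ≤ 4 * A₁.card * energyAt A₁ a := hae
      _ ≤ 4 * A₁.card * (l * (((levelSet A₁ j).filter fun c => a - c ∈ A₁).card *
          (4 * ((2 : ℝ) ^ j) ^ 2))) := by
          refine mul_le_mul_of_nonneg_left (h2.trans ?_) (by positivity)
          gcongr
      _ = _ := by ring

/-- Apply the rich-point bound with C the common level set of differences in the second coordinate.
The two coordinates trade off: large third energy in one forces small third moments in the other. -/
theorem exists_subset_cubeBound {Γ : Finset (ℝ × ℝ)} (hΓ : IsSidonCurve Γ) (hne : Γ.Nonempty)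
    {n : ℕ} (hn : Γ.card ≤ n) :
    ∃ Δ ⊆ Γ, (Γ.card : ℝ) ≤ 16 * (Nat.log 2 n + 1 : ℕ) ^ 2 * Δ.card ∧
      ∃ D : ℝ, 0 ≤ D ∧ CubeBound (Δ.image Prod.fst) D ∧
        D * energyThree (Δ.image Prod.snd) ≤
          3276800 * (Nat.log 2 n + 1 : ℕ) ^ 4 * (n : ℝ) ^ 5 := by
  have hcardA : (Γ.image Prod.snd).card = Γ.card := Finset.card_image_of_injOn hΓ.injOn_snd
  obtain ⟨A₁, hA₁, A₂, hA₂, j, hne₁, hc, hr⟩ :=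
    exists_subset_same_level (Γ.image Prod.snd) (hne.image _) (hcardA.trans_le hn)
  set l : ℕ := Nat.log 2 n + 1 with hl
  have hl1 : (1 : ℝ) ≤ l := by exact_mod_cast Nat.succ_le_succ (Nat.zero_le _)
  set Δ := Γ.filter fun p => p.2 ∈ A₂ with hΔ
  have hΔΓ : Δ ⊆ Γ := Finset.filter_subset _ _
  have hC := hΓ.subset hΔΓ
  have hsnd : Δ.image Prod.snd = A₂ := by
    ext a
    simp only [hΔ, Finset.mem_image, Finset.mem_filter]
    constructor
    · rintro ⟨p, ⟨_, hp⟩, rfl⟩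
      exact hp
    · intro ha
      obtain ⟨p, hp, rfl⟩ := Finset.mem_image.1 (hA₁ (hA₂ ha))
      exact ⟨p, ⟨hp, ha⟩, rfl⟩
  have hcard : Δ.card = A₂.card := by
    rw [← hsnd, Finset.card_image_of_injOn hC.injOn_snd]
  have hA₁0 : (0 : ℝ) < A₁.card := by exact_mod_cast hne₁.card_pos
  have hA₁n : (A₁.card : ℝ) ≤ n := by
    exact_mod_cast (Finset.card_le_card hA₁).trans (hcardA.trans_le hn)
  have hE : 0 < energyThree A₁ := lt_of_lt_of_le (by positivity) (card_pow_three_le_energyThree A₁)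
  set E := energyThree A₁ with hEdef
  set τ : ℝ := (2 : ℝ) ^ j with hτ
  have hτ0 : 0 < τ := by positivity
  have hlev := card_levelSet_mul_le A₁ j
  rw [← hτ, ← hEdef] at hlev
  refine ⟨Δ, hΔΓ, by rw [← hcardA, hcard]; exact hc,
    8 * l * (409600 * l ^ 3 * A₁.card ^ 5 / E), by positivity, ?_, ?_⟩
  · intro X Y
    have hmain : ∀ t : ℕ, 0 < t →
        ((Y.filter fun y => t ≤ diffRep (Δ.image Prod.fst) X y).card : ℝ) * (t : ℝ) ^ 3 ≤
          409600 * l ^ 3 * A₁.card ^ 5 / E * X.card ^ 2 := by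
      intro t ht
      have ht0 : (0 : ℝ) < t := by exact_mod_cast ht
      set Y' := Y.filter fun y => t ≤ diffRep (Δ.image Prod.fst) X y with hY'
      have h1 := card_mul_pow_three_le_of_rich hC X Y' (levelSet A₁ j) A₁
        (t := t) (R := E / (16 * A₁.card * l * τ ^ 2)) ht0 (by positivity)
        (fun y hy => by exact_mod_cast (Finset.mem_filter.1 hy).2)
        (fun p hp => by
          rw [div_le_iff₀ (by positivity), mul_comm]
          exact hr _ (Finset.mem_filter.1 hp).2)
        (hcard.trans_le (Finset.card_le_card hA₂))
      have h2 : ((levelSet A₁ j).card : ℝ) ≤ E / τ ^ 3 := by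
        rwa [le_div_iff₀ (by positivity)]
      have h3 : (Y'.card : ℝ) * t ^ 3 * (E / (16 * A₁.card * l * τ ^ 2)) ^ 3 ≤
          100 * A₁.card ^ 2 * X.card ^ 2 * (E / τ ^ 3) ^ 2 := by
        refine h1.trans ?_
        gcongr
      rw [← le_div_iff₀ (by positivity)] at h3
      -- R³ scales as τ⁻⁶, as does the bound (E/τ³)² for |C|², so the unknown level τ disappears.
      refine h3.trans (le_of_eq ?_)
      field_simp
      ring
    refine (sum_pow_three_le_of_level_bound Y (fun y => diffRep (Δ.image Prod.fst) X y)
      (n := n) (fun y _ => ?_) hmain).trans (le_of_eq (by rw [← hl]; ring))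
    exact (diffRep_le_card_left _ _ _).trans
      (Finset.card_image_le.trans ((Finset.card_le_card hΔΓ).trans hn))
  · rw [hsnd]
    have hle : energyThree A₂ ≤ E := energyThree_mono hA₂
    calc 8 * (l : ℝ) * (409600 * l ^ 3 * A₁.card ^ 5 / E) * energyThree A₂
        ≤ 8 * l * (409600 * l ^ 3 * A₁.card ^ 5 / E) * E := by gcongr
      _ = 3276800 * (l : ℝ) ^ 4 * (A₁.card : ℝ) ^ 5 := by
          field_simp
          ring
      _ ≤ _ := by gcongr

/-! ### The Katz–Koester energy bound. -/

/-- Hölder with exponents 3 and 3/2, obtained from two applications of Cauchy–Schwarz to keep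
integer powers. -/
theorem sum_mul_sq_pow_three_le {ι : Type*} (s : Finset ι) {f g : ι → ℝ}
    (hf : ∀ i ∈ s, 0 ≤ f i) (hg : ∀ i ∈ s, 0 ≤ g i) :
    (∑ i ∈ s, f i * g i ^ 2) ^ 3 ≤ (∑ i ∈ s, f i ^ 3) * (∑ i ∈ s, g i ^ 3) ^ 2 := by
  have h1 : (∑ i ∈ s, f i * g i ^ 2) ^ 2 ≤ (∑ i ∈ s, f i ^ 2 * g i) * ∑ i ∈ s, g i ^ 3 :=
    Finset.sum_sq_le_sum_mul_sum_of_sq_le_mul s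
      (fun i hi => mul_nonneg (sq_nonneg _) (hg i hi)) (fun i hi => pow_nonneg (hg i hi) 3)
      (fun i _ => le_of_eq (by ring))
  have h2 : (∑ i ∈ s, f i ^ 2 * g i) ^ 2 ≤ (∑ i ∈ s, f i ^ 3) * ∑ i ∈ s, f i * g i ^ 2 :=
    Finset.sum_sq_le_sum_mul_sum_of_sq_le_mul s
      (fun i hi => pow_nonneg (hf i hi) 3) (fun i hi => mul_nonneg (hf i hi) (sq_nonneg _))
      (fun i _ => le_of_eq (by ring))
  set X := ∑ i ∈ s, f i * g i ^ 2
  set Y := ∑ i ∈ s, f i ^ 2 * g i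
  set F := ∑ i ∈ s, f i ^ 3
  set G := ∑ i ∈ s, g i ^ 3
  have hX : 0 ≤ X := Finset.sum_nonneg fun i hi => mul_nonneg (hf i hi) (sq_nonneg _)
  have hF : 0 ≤ F := Finset.sum_nonneg fun i hi => pow_nonneg (hf i hi) 3
  rcases hX.eq_or_lt with h0 | h0
  · rw [← h0, zero_pow (by norm_num)]
    exact mul_nonneg hF (sq_nonneg _)
  · refine le_of_mul_le_mul_left ?_ h0
    calc X * X ^ 3 = (X ^ 2) ^ 2 := by ring
      _ ≤ (Y * G) ^ 2 := by gcongr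
      _ = Y ^ 2 * G ^ 2 := by ring
      _ ≤ (F * X) * G ^ 2 := by gcongr
      _ = _ := by ring

theorem sum_mul_pow_six_le {ι : Type*} (s : Finset ι) {p q : ι → ℝ}
    (hp : ∀ i ∈ s, 0 ≤ p i) (hq : ∀ i ∈ s, 0 ≤ q i) :
    (∑ i ∈ s, p i * q i) ^ 6 ≤
      (∑ i ∈ s, p i) ^ 3 * (∑ i ∈ s, p i ^ 3) * (∑ i ∈ s, q i ^ 3) ^ 2 := by
  have h1 : (∑ i ∈ s, p i * q i) ^ 2 ≤ (∑ i ∈ s, p i) * ∑ i ∈ s, p i * q i ^ 2 :=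
    Finset.sum_sq_le_sum_mul_sum_of_sq_le_mul s hp
      (fun i hi => mul_nonneg (hp i hi) (sq_nonneg _)) (fun i _ => le_of_eq (by ring))
  have h2 := sum_mul_sq_pow_three_le s hp hq
  have h3 : 0 ≤ ∑ i ∈ s, p i := Finset.sum_nonneg hp
  calc (∑ i ∈ s, p i * q i) ^ 6 = ((∑ i ∈ s, p i * q i) ^ 2) ^ 3 := by ring
    _ ≤ ((∑ i ∈ s, p i) * ∑ i ∈ s, p i * q i ^ 2) ^ 3 := by gcongr
    _ = (∑ i ∈ s, p i) ^ 3 * (∑ i ∈ s, p i * q i ^ 2) ^ 3 := by ring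
    _ ≤ (∑ i ∈ s, p i) ^ 3 * ((∑ i ∈ s, p i ^ 3) * (∑ i ∈ s, q i ^ 3) ^ 2) := by gcongr
    _ = _ := by ring

theorem card_sq_le_card_mul_card_collisions {α β : Type*} [DecidableEq α] [DecidableEq β]
    (T : Finset α) (U : Finset β) (φ : α → β) (hφ : ∀ t ∈ T, φ t ∈ U) :
    T.card ^ 2 ≤ U.card * ((T ×ˢ T).filter fun p => φ p.1 = φ p.2).card := by
  rw [Finset.card_eq_sum_card_fiberwise (f := φ) (s := T) (t := U) hφ,
    Finset.card_eq_sum_card_fiberwise (f := fun p : α × α => φ p.1)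
      (s := (T ×ˢ T).filter fun p => φ p.1 = φ p.2) (t := U) (fun p hp =>
        hφ _ (Finset.mem_product.1 (Finset.mem_filter.1 (Finset.mem_coe.1 hp)).1).1)]
  refine sq_sum_le_card_mul_sum_sq.trans (Nat.mul_le_mul_left _ (Finset.sum_le_sum fun u _ => ?_))
  rw [sq, ← Finset.card_product]
  refine Finset.card_le_card fun p hp => ?_
  simp only [Finset.mem_product, Finset.mem_filter] at hp ⊢
  exact ⟨⟨⟨hp.1.1, hp.2.1⟩, hp.1.2.trans hp.2.2.symm⟩, hp.1.2⟩

/-- The triples `(b, a, a')` with `a - a' ∈ D` and `a + b ∈ P`. -/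
noncomputable def sumTriples (A B D P : Finset ℝ) : Finset (ℝ × ℝ × ℝ) :=
  (B ×ˢ A ×ˢ A).filter fun t => t.2.1 - t.2.2 ∈ D ∧ t.2.1 + t.1 ∈ P

/-- Two triples with the same image (a + b, a' + b) shift a, a' and -b by one common amount x, so
each x contributes one representation count in B - B and two in A - A. -/
theorem card_collisions_sumTriples_le {A' A : Finset ℝ} (hA : A' ⊆ A) (B D P : Finset ℝ) :
    (((sumTriples A' B D P ×ˢ sumTriples A' B D P).filter fun p =>
      (p.1.2.1 + p.1.1, p.1.2.2 + p.1.1) = (p.2.2.1 + p.2.1, p.2.2.2 + p.2.1)).card : ℝ) ≤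
      ∑ x ∈ A - A, (diffRep B B x : ℝ) * (diffRep A A x : ℝ) ^ 2 := by
  have h : ((sumTriples A' B D P ×ˢ sumTriples A' B D P).filter fun p =>
      (p.1.2.1 + p.1.1, p.1.2.2 + p.1.1) = (p.2.2.1 + p.2.1, p.2.2.2 + p.2.1)).card ≤
      ((A - A).sigma fun x => ((B ×ˢ B).filter fun p => p.1 - p.2 = x) ×ˢ
        ((A ×ˢ A).filter fun p => p.1 - p.2 = x) ×ˢ
        ((A ×ˢ A).filter fun p => p.1 - p.2 = x)).card := by
    refine Finset.card_le_card_of_injOn (fun p => ⟨p.1.2.1 - p.2.2.1,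
      ((p.2.1, p.1.1), (p.1.2.1, p.2.2.1), (p.1.2.2, p.2.2.2))⟩) ?_ ?_
    · rintro ⟨⟨b, a, a'⟩, c, d, d'⟩ hp
      simp only [sumTriples, Finset.coe_filter, Finset.mem_product, Finset.mem_filter,
        Set.mem_ofPred_eq, Prod.mk.injEq] at hp
      obtain ⟨⟨⟨⟨hb, ha, ha'⟩, -⟩, ⟨hc, hd, hd'⟩, -⟩, e1, e2⟩ := hp
      simp only [Finset.coe_sigma, Set.mem_sigma_iff, Finset.mem_coe, Finset.mem_product,
        Finset.mem_filter]
      exact ⟨Finset.sub_mem_sub (hA ha) (hA hd), ⟨⟨hc, hb⟩, by linarith⟩,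
        ⟨⟨hA ha, hA hd⟩, trivial⟩, ⟨hA ha', hA hd'⟩, by linarith⟩
    · rintro ⟨⟨b, a, a'⟩, c, d, d'⟩ _ ⟨⟨b₁, a₁, a₁'⟩, c₁, d₁, d₁'⟩ _ he
      simp only [Sigma.mk.injEq, heq_eq_eq, Prod.mk.injEq] at he ⊢
      tauto
  refine (Nat.cast_le.2 h).trans (le_of_eq ?_)
  rw [Finset.card_sigma]
  push_cast
  refine Finset.sum_congr rfl fun x _ => ?_
  rw [Finset.card_product, Finset.card_product, diffRep, diffRep]
  push_cast
  ring

/-- Writing a + b - s' = δ with δ in `D` as a - δ = s' - b turns the count into a correlation of A -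
D with S - B. -/
theorem sum_card_sumReps_le (A B D P S : Finset ℝ) :
    (∑ u ∈ (P ×ˢ S).filter (fun u => u.1 - u.2 ∈ D),
      (((A ×ˢ B).filter fun p => p.1 + p.2 = u.1).card : ℝ)) ≤
      ∑ y ∈ A - D, (diffRep A D y : ℝ) * (diffRep S B y : ℝ) := by
  have h : (((P ×ˢ S).filter fun u => u.1 - u.2 ∈ D).sigma fun u =>
      (A ×ˢ B).filter fun p => p.1 + p.2 = u.1).card ≤
      ((A - D).sigma fun y => ((A ×ˢ D).filter fun p => p.1 - p.2 = y) ×ˢ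
        ((S ×ˢ B).filter fun p => p.1 - p.2 = y)).card := by
    refine Finset.card_le_card_of_injOn (fun v => ⟨v.2.1 - (v.1.1 - v.1.2),
      ((v.2.1, v.1.1 - v.1.2), (v.1.2, v.2.2))⟩) ?_ ?_
    · rintro ⟨⟨s, s'⟩, a, b⟩ hv
      simp only [Finset.coe_sigma, Set.mem_sigma_iff, Finset.mem_coe, Finset.mem_product,
        Finset.mem_filter] at hv ⊢
      obtain ⟨⟨⟨hs, hs'⟩, hD⟩, ⟨ha, hb⟩, e⟩ := hv
      exact ⟨Finset.sub_mem_sub ha hD, ⟨⟨ha, hD⟩, trivial⟩, ⟨hs', hb⟩, by linarith⟩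
    · rintro ⟨⟨s, s'⟩, a, b⟩ _ ⟨⟨s₁, s₁'⟩, a₁, b₁⟩ _ he
      simp only [Sigma.mk.injEq, heq_eq_eq, Prod.mk.injEq] at he ⊢
      obtain ⟨_, ⟨h1, h2⟩, h3, h4⟩ := he
      subst h3
      exact ⟨⟨by linarith, rfl⟩, h1, h4⟩
  rw [Finset.card_sigma, Finset.card_sigma] at h
  simp only [Finset.card_product] at h
  exact_mod_cast h

/-- The elements of `A + B` with at least half the average number of representations. -/
noncomputable def popularSums (A B : Finset ℝ) : Finset ℝ :=
  (A + B).filter fun s => ((A.card : ℝ) * B.card) ≤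
    2 * (A + B).card * ((A ×ˢ B).filter fun p => p.1 + p.2 = s).card

/-- The elements of `A` with many popular sums. -/
noncomputable def popularPart (A B : Finset ℝ) : Finset ℝ :=
  A.filter fun a => (B.card : ℝ) ≤ 4 * (B.filter fun b => a + b ∈ popularSums A B).card

/-- Unpopular sums absorb at most half of the pairs, and points outside the popular part contribute
at most a quarter of the pairs through popular sums. -/
theorem card_le_card_popularPart (A B : Finset ℝ) (hB : B.Nonempty) :
    (A.card : ℝ) ≤ 4 * (popularPart A B).card := by
  rcases A.eq_empty_or_nonempty with rfl | hA
  · simp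
  have hB0 : (0 : ℝ) < B.card := by exact_mod_cast hB.card_pos
  have hσ : (0 : ℝ) < (A + B).card := by exact_mod_cast (hA.add hB).card_pos
  have htot : ((A ×ˢ B).card : ℝ) =
      ((A ×ˢ B).filter fun p => p.1 + p.2 ∈ popularSums A B).card +
      ((A ×ˢ B).filter fun p => ¬ p.1 + p.2 ∈ popularSums A B).card := by
    exact_mod_cast (Finset.card_filter_add_card_filter_not _).symm
  rw [Finset.card_product] at htot
  push_cast at htot
  have hunpop : 2 * (((A ×ˢ B).filter fun p => ¬ p.1 + p.2 ∈ popularSums A B).card : ℝ) ≤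
      A.card * B.card := by
    have h1 := Finset.card_eq_sum_card_fiberwise (f := fun p : ℝ × ℝ => p.1 + p.2)
      (s := (A ×ˢ B).filter fun p => ¬ p.1 + p.2 ∈ popularSums A B)
      (t := (A + B).filter fun s => s ∉ popularSums A B) (fun p hp => by
        obtain ⟨h1, h2⟩ := Finset.mem_filter.1 (Finset.mem_coe.1 hp)
        rw [Finset.mem_product] at h1
        exact Finset.mem_coe.2 (Finset.mem_filter.2 ⟨Finset.add_mem_add h1.1 h1.2, h2⟩))
    have h2 : 2 * ((A + B).card : ℝ) *
        (((A ×ˢ B).filter fun p => ¬ p.1 + p.2 ∈ popularSums A B).card : ℝ) ≤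
        ((A + B).filter fun s => s ∉ popularSums A B).card * (A.card * B.card) := by
      rw [h1, Nat.cast_sum, Finset.mul_sum, ← nsmul_eq_mul]
      refine Finset.sum_le_card_nsmul _ _ _ fun s hs => ?_
      obtain ⟨hs1, hs2⟩ := Finset.mem_filter.1 hs
      have h3 : ¬ ((A.card : ℝ) * B.card) ≤
          2 * (A + B).card * ((A ×ˢ B).filter fun p => p.1 + p.2 = s).card :=
        fun h => hs2 (Finset.mem_filter.2 ⟨hs1, h⟩)
      push Not at h3
      refine le_trans ?_ h3.le
      gcongr
      exact Finset.filter_subset _ _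
    have h3 : (((A + B).filter fun s => s ∉ popularSums A B).card : ℝ) ≤ (A + B).card := by
      exact_mod_cast Finset.card_filter_le _ _
    refine le_of_mul_le_mul_left ?_ hσ
    calc _ = 2 * ((A + B).card : ℝ) *
        (((A ×ˢ B).filter fun p => ¬ p.1 + p.2 ∈ popularSums A B).card : ℝ) := by ring
      _ ≤ _ := h2
      _ ≤ _ := by gcongr
  have hpop : (((A ×ˢ B).filter fun p => p.1 + p.2 ∈ popularSums A B).card : ℝ) ≤
      (popularPart A B).card * B.card + A.card * (B.card / 4) := by
    rw [Finset.card_filter, Finset.sum_product]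
    push_cast
    calc (∑ a ∈ A, ∑ b ∈ B, if a + b ∈ popularSums A B then (1 : ℝ) else 0)
        ≤ ∑ a ∈ A, ((if a ∈ popularPart A B then (B.card : ℝ) else 0) + B.card / 4) := by
          refine Finset.sum_le_sum fun a ha => ?_
          have h1 : (∑ b ∈ B, if a + b ∈ popularSums A B then (1 : ℝ) else 0) =
              (B.filter fun b => a + b ∈ popularSums A B).card := by simp
          rw [h1]
          split_ifs with h
          · have : ((B.filter fun b => a + b ∈ popularSums A B).card : ℝ) ≤ B.card := by
              exact_mod_cast Finset.card_filter_le _ _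
            linarith
          · have h3 : ¬ (B.card : ℝ) ≤ 4 * (B.filter fun b => a + b ∈ popularSums A B).card :=
              fun h' => h (Finset.mem_filter.2 ⟨ha, h'⟩)
            push Not at h3
            linarith
      _ = _ := by
          rw [Finset.sum_add_distrib, Finset.sum_const, nsmul_eq_mul, ← Finset.sum_filter,
            Finset.sum_const, nsmul_eq_mul,
            Finset.filter_mem_eq_inter, Finset.inter_eq_right.2 (show popularPart A B ⊆ A from Finset.filter_subset _ _)]
  nlinarith

/-- The additive energy of `A`, counted through differences. -/
noncomputable def energyTwo (A : Finset ℝ) : ℝ := ∑ x ∈ A - A, (diffRep A A x : ℝ) ^ 2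

theorem katzKoester_algebra {m d τ σ DA DB EA EB E l U T Z W : ℝ} (hm0 : 0 < m) (hd0 : 0 < d)
    (hτ0 : 0 < τ) (hσ0 : 0 < σ) (hDA : 0 ≤ DA)
    (hE0 : 0 ≤ E) (hl0 : 0 ≤ l) (hW0 : 0 ≤ W)
    (hTU : T ^ 2 ≤ U * W) (hTlow : m / 4 * (d * τ) ≤ T) (hUZ : m ^ 2 * U ≤ 2 * σ * Z)
    (hW3 : W ^ 3 ≤ EB * EA ^ 2)
    (hZ6 : Z ^ 6 ≤ (m * d) ^ 3 * (DA * d ^ 2) * (DB * σ ^ 2) ^ 2) (hlev : d * τ ^ 3 ≤ EA)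
    (hE : E ≤ l * (d * (4 * τ ^ 2))) :
    m ^ 21 * E ^ 9 ≤ 2 ^ 48 * l ^ 9 * σ ^ 10 * (DA * DB ^ 2) * EB ^ 2 * EA ^ 6 := by
  have hcomb : m ^ 2 * (m / 4 * (d * τ)) ^ 2 ≤ 2 * σ * Z * W := by
    calc m ^ 2 * (m / 4 * (d * τ)) ^ 2 ≤ m ^ 2 * T ^ 2 := by gcongr
      _ ≤ m ^ 2 * (U * W) := by gcongr
      _ = m ^ 2 * U * W := by ring
      _ ≤ _ := by gcongr
  have hpow : (m ^ 2 * (m / 4 * (d * τ)) ^ 2) ^ 6 ≤ 2 ^ 6 * σ ^ 6 *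
      ((m * d) ^ 3 * (DA * d ^ 2) * (DB * σ ^ 2) ^ 2) *
        (EB * EA ^ 2) ^ 2 := by
    calc _ ≤ (2 * σ * Z * W) ^ 6 := by gcongr
      _ = 2 ^ 6 * σ ^ 6 * Z ^ 6 * (W ^ 3) ^ 2 := by ring
      _ ≤ _ := by gcongr
  have hcancel : m ^ 21 * (d ^ 7 * τ ^ 12) ≤
      2 ^ 30 * σ ^ 10 * (DA * DB ^ 2) * EB ^ 2 * EA ^ 4 := by
    -- The Hölder bound for Z⁶ contributes m³d⁵, cancelled from m²⁴d¹²τ¹². The remaining d⁷τ¹² is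
    -- two factors of dτ³ short of E⁹ ≲ d⁹τ¹⁸; `hlev` supplies them.
    have hpos : 0 < m ^ 3 * d ^ 5 := by positivity
    refine le_of_mul_le_mul_left ?_ hpos
    have h1 : (m ^ 2 * (m / 4 * (d * τ)) ^ 2) ^ 6 =
        m ^ 3 * d ^ 5 * (m ^ 21 * (d ^ 7 * τ ^ 12)) / 2 ^ 24 := by ring
    rw [h1, div_le_iff₀ (by positivity)] at hpow
    refine hpow.trans (le_of_eq (by ring))
  calc m ^ 21 * E ^ 9 ≤ m ^ 21 * (l * (d * (4 * τ ^ 2))) ^ 9 := by gcongr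
    _ = 2 ^ 18 * l ^ 9 * (m ^ 21 * (d ^ 7 * τ ^ 12)) * (d * τ ^ 3) ^ 2 := by ring
    _ ≤ 2 ^ 18 * l ^ 9 * (2 ^ 30 * σ ^ 10 * (DA * DB ^ 2) * EB ^ 2 *
        EA ^ 4) * EA ^ 2 := by gcongr
    _ = _ := by ring

/-- Take `D` a dyadic level carrying the energy of the popular part. Each pair with difference in
`D` can be shifted by at least m/4 elements of `B` with its first sum popular; Cauchy–Schwarz bounds
these triples by the pairs of sums U and the collisions W. Popularity then replaces each first sum
by its many representations, giving Z. -/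
theorem katzKoester_bound {A B : Finset ℝ} {m n : ℕ} (hm : 0 < m) (hA : A.card = m)
    (hB : B.card = m) (hmn : m ≤ n) {DA DB : ℝ} (hDA : 0 ≤ DA)
    (hCA : CubeBound A DA) (hCB : CubeBound B DB) :
    (m : ℝ) ^ 21 * energyTwo (popularPart A B) ^ 9 ≤
      2 ^ 48 * (Nat.log 2 n + 1 : ℕ) ^ 9 * ((A + B).card : ℝ) ^ 10 *
        (DA * DB ^ 2) * energyThree B ^ 2 * energyThree A ^ 6 := by
  set A' := popularPart A B with hA'
  have hsub : A' ⊆ A := Finset.filter_subset _ _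
  set P := popularSums A B with hP
  set S := A + B with hS
  set σ : ℝ := (S.card : ℝ) with hσ
  have hm0 : (0 : ℝ) < m := by exact_mod_cast hm
  have hAne : A.Nonempty := Finset.card_pos.1 (by omega)
  have hBne : B.Nonempty := Finset.card_pos.1 (by omega)
  have hσ0 : 0 < σ := Nat.cast_pos.2 (hAne.add hBne).card_pos
  obtain ⟨j, hj⟩ := exists_level (A' - A') (fun x => diffRep A' A' x) (n := n)
    (fun x _ => (diffRep_le_card_left _ _ _).trans
      ((Finset.card_le_card hsub).trans (hA.le.trans hmn)))
    (fun x => (diffRep A' A' x : ℝ) ^ 2)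
  set l : ℝ := ((Nat.log 2 n + 1 : ℕ) : ℝ) with hl
  set τ : ℝ := (2 : ℝ) ^ j with hτ
  have hτ0 : 0 < τ := by positivity
  set D := levelSet A' j with hD
  set d : ℝ := (D.card : ℝ) with hd
  have hE : energyTwo A' ≤ l * (d * (4 * τ ^ 2)) := by
    refine hj.trans ?_
    have := sum_sq_level_le (A' - A') (fun x => diffRep A' A' x) j
    gcongr
    exact this
  have hE0 : 0 ≤ energyTwo A' := Finset.sum_nonneg fun _ _ => by positivity
  have h3A := energyThree_nonneg A
  have h3B := energyThree_nonneg B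
  rcases (Nat.cast_nonneg D.card : (0 : ℝ) ≤ (D.card : ℝ)).eq_or_lt with h0 | hd0
  · rw [← hd] at h0
    rw [← h0] at hE
    have : energyTwo A' = 0 := le_antisymm (by simpa using hE) hE0
    rw [this]
    simp only [ne_eq, OfNat.ofNat_ne_zero, not_false_eq_true, zero_pow, mul_zero]
    positivity
  rw [← hd] at hd0
  set T := sumTriples A' B D P with hT
  set U := (P ×ˢ S).filter fun u => u.1 - u.2 ∈ D with hU
  set W : ℝ := ∑ x ∈ A - A, (diffRep B B x : ℝ) * (diffRep A A x : ℝ) ^ 2 with hW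
  set Z : ℝ := ∑ y ∈ A - D, (diffRep A D y : ℝ) * (diffRep S B y : ℝ) with hZ
  have hTU : (T.card : ℝ) ^ 2 ≤ U.card * W := by
    have h1 := card_sq_le_card_mul_card_collisions T U
      (fun t => (t.2.1 + t.1, t.2.2 + t.1)) (by
        rintro ⟨b, a, a'⟩ ht
        simp only [hT, sumTriples, Finset.mem_filter, Finset.mem_product] at ht
        simp only [hU, Finset.mem_filter, Finset.mem_product]
        refine ⟨⟨ht.2.2, Finset.add_mem_add (hsub ht.1.2.2) ht.1.1⟩, ?_⟩
        rw [add_sub_add_right_eq_sub]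
        exact ht.2.1)
    have h2 := card_collisions_sumTriples_le hsub B D P
    have h3 := (Nat.cast_le (α := ℝ)).2 h1
    rw [Nat.cast_pow, Nat.cast_mul] at h3
    exact h3.trans (mul_le_mul_of_nonneg_left h2 (Nat.cast_nonneg _))
  have hTlow : m / 4 * (d * τ) ≤ T.card := by
    have h1 : (T.card : ℝ) = ∑ p ∈ (A' ×ˢ A').filter (fun p => p.1 - p.2 ∈ D),
        ((B.filter fun b => p.1 + b ∈ P).card : ℝ) := by
      have h2 := Finset.card_eq_sum_card_fiberwise (f := fun t : ℝ × ℝ × ℝ => t.2)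
        (s := T) (t := (A' ×ˢ A').filter (fun p => p.1 - p.2 ∈ D)) (by
          rintro ⟨b, a, a'⟩ ht
          have ht := Finset.mem_coe.1 ht
          simp only [hT, sumTriples, Finset.mem_filter, Finset.mem_product] at ht
          exact Finset.mem_coe.2 (Finset.mem_filter.2
            ⟨Finset.mem_product.2 ht.1.2, ht.2.1⟩))
      rw [h2, Nat.cast_sum]
      refine Finset.sum_congr rfl fun p hp => ?_
      rw [Nat.cast_inj]
      have hp' := Finset.mem_filter.1 hp
      have hp'' := Finset.mem_product.1 hp'.1
      refine Finset.card_nbij' (fun t => t.1) (fun b => (b, p)) ?_ ?_ ?_ (fun _ _ => rfl)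
      · rintro ⟨b, q⟩ ht
        simp only [hT, sumTriples, Finset.coe_filter, Finset.mem_filter, Finset.mem_product,
          Set.mem_ofPred_eq] at ht ⊢
        obtain ⟨⟨h1, h2⟩, rfl⟩ := ht
        exact ⟨h1.1, h2.2⟩
      · intro b hb
        simp only [hT, sumTriples, Finset.coe_filter, Finset.mem_filter, Finset.mem_product,
          Set.mem_ofPred_eq] at hb ⊢
        exact ⟨⟨⟨hb.1, hp''⟩, hp'.2, hb.2⟩, trivial⟩
      · rintro ⟨b, q⟩ ht
        have ht := Finset.mem_filter.1 (Finset.mem_coe.1 ht)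
        simp only [Prod.mk.injEq, true_and]
        exact ht.2.symm
    have h3 : d * τ ≤ ((A' ×ˢ A').filter (fun p => p.1 - p.2 ∈ D)).card := by
      rw [← sum_diffRep, ← nsmul_eq_mul]
      exact Finset.card_nsmul_le_sum _ _ _ fun x hx => two_pow_le_diffRep_of_mem_levelSet hx
    calc m / 4 * (d * τ) ≤ m / 4 * ((A' ×ˢ A').filter (fun p => p.1 - p.2 ∈ D)).card := by
          gcongr
      _ ≤ T.card := by
          rw [h1, mul_comm, ← nsmul_eq_mul]
          refine Finset.card_nsmul_le_sum _ _ _ fun p hp => ?_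
          have hp' := Finset.mem_product.1 (Finset.mem_filter.1 hp).1
          have h4 := (Finset.mem_filter.1 hp'.1).2
          rw [hB] at h4
          rw [div_le_iff₀ (by norm_num), mul_comm]
          exact h4
  have hUZ : (m : ℝ) ^ 2 * U.card ≤ 2 * σ * Z := by
    have h1 := sum_card_sumReps_le A B D P S
    calc (m : ℝ) ^ 2 * U.card = ∑ u ∈ U, (m : ℝ) ^ 2 := by
          rw [Finset.sum_const, nsmul_eq_mul, mul_comm]
      _ ≤ ∑ u ∈ U, 2 * σ * (((A ×ˢ B).filter fun p => p.1 + p.2 = u.1).card : ℝ) := by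
          refine Finset.sum_le_sum fun u hu => ?_
          have h2 := (Finset.mem_product.1 (Finset.mem_filter.1 hu).1).1
          have h3 := (Finset.mem_filter.1 h2).2
          rw [hA, hB] at h3
          rw [sq]
          exact h3
      _ ≤ _ := by
          rw [← Finset.mul_sum]
          gcongr
  have hW3 : W ^ 3 ≤ energyThree B * energyThree A ^ 2 := by
    refine (sum_mul_sq_pow_three_le (A - A) (fun _ _ => by positivity)
      (fun _ _ => by positivity)).trans ?_
    have h1 := sum_cube_le_energyThree B (A - A)
    rw [← energyThree]
    gcongr
  have hZ6 : Z ^ 6 ≤ (m * d) ^ 3 * (DA * d ^ 2) * (DB * σ ^ 2) ^ 2 := by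
    refine (sum_mul_pow_six_le (A - D) (fun _ _ => by positivity)
      (fun _ _ => by positivity)).trans ?_
    have h1 : ∑ y ∈ A - D, (diffRep A D y : ℝ) ≤ m * d := by
      rw [sum_diffRep, ← hA, hd]
      exact_mod_cast (Finset.card_filter_le _ _).trans (Finset.card_product _ _).le
    have h2 := hCA D (A - D)
    have h3 : ∑ y ∈ A - D, (diffRep S B y : ℝ) ^ 3 ≤ DB * σ ^ 2 := by
      refine le_trans (le_of_eq ?_) (hCB S ((A - D).image Neg.neg))
      rw [Finset.sum_image neg_injective.injOn]
      exact Finset.sum_congr rfl fun y _ => by rw [diffRep_neg]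
    have h4 : 0 ≤ ∑ y ∈ A - D, (diffRep A D y : ℝ) := Finset.sum_nonneg fun _ _ => by positivity
    have h5 : 0 ≤ ∑ y ∈ A - D, (diffRep S B y : ℝ) ^ 3 := Finset.sum_nonneg fun _ _ => by positivity
    exact mul_le_mul (mul_le_mul (pow_le_pow_left₀ h4 h1 3) h2
      (Finset.sum_nonneg fun _ _ => by positivity) (by positivity)) (pow_le_pow_left₀ h5 h3 2)
      (by positivity) (by positivity)
  have hlev : d * τ ^ 3 ≤ energyThree A :=
    (card_levelSet_mul_le A' j).trans (energyThree_mono hsub)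
  have hW0 : 0 ≤ W := Finset.sum_nonneg fun _ _ => by positivity
  exact katzKoester_algebra hm0 hd0 hτ0 hσ0 hDA hE0 (Nat.cast_nonneg _)
    hW0 hTU hTlow hUZ hW3 hZ6 hlev hE

/-! ### Graphs of convex functions are Sidon curves. -/

/-- Secant slopes increase strictly when an endpoint moves right, so sliding a chord of fixed width
changes its increment. -/
theorem StrictConvexOn.eq_of_sub_eq_sub {I : Set ℝ} {f : ℝ → ℝ} (hf : StrictConvexOn ℝ I f)
    {a b a' b' : ℝ} (ha : a ∈ I) (hb : b ∈ I) (ha' : a' ∈ I) (hb' : b' ∈ I) (hne : a ≠ b)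
    (h : a - b = a' - b') (hfab : f a - f b = f a' - f b') : a = a' := by
  have main : ∀ a ∈ I, ∀ b ∈ I, ∀ a' ∈ I, ∀ b' ∈ I, b < a → a - b = a' - b' → a < a' →
      f a - f b < f a' - f b' := by
    intro a ha b hb a' ha' b' hb' hlt h hlt'
    have h1 := hf.secant_strict_mono hb ha ha' hlt.ne' (hlt.trans hlt').ne' hlt'
    have h2 := hf.secant_strict_mono ha' hb hb' (hlt.trans hlt').ne (by linarith) (by linarith)
    have e1 : (f b - f a') / (b - a') = (f a' - f b) / (a' - b) := by
      rw [← neg_sub (f a'), ← neg_sub a', neg_div_neg_eq]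
    have e2 : (f b' - f a') / (b' - a') = (f a' - f b') / (a' - b') := by
      rw [← neg_sub (f a'), ← neg_sub a', neg_div_neg_eq]
    rw [e1, e2] at h2
    have h3 := h1.trans h2
    rwa [← h, div_lt_div_iff_of_pos_right (by linarith)] at h3
  by_contra haa
  rcases lt_or_gt_of_ne hne with h1 | h1 <;> rcases lt_or_gt_of_ne haa with h2 | h2
  · have := main b hb a ha b' hb' a' ha' h1 (by linarith) (by linarith)
    linarith
  · have := main b' hb' a' ha' b hb a ha (by linarith) (by linarith) (by linarith)
    linarith
  · have := main a ha b hb a' ha' b' hb' h1 h h2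
    linarith
  · have := main a' ha' b' hb' a ha b hb (by linarith) h.symm h2
    linarith

/-- Split at a minimiser of f on `A`: f strictly increases to its right and strictly decreases to
its left. -/
theorem StrictConvexOn.exists_subset_strictMonoOn {I : Set ℝ} {f : ℝ → ℝ}
    (hf : StrictConvexOn ℝ I f) {A : Finset ℝ} (hA : (A : Set ℝ) ⊆ I) (hne : A.Nonempty) :
    ∃ B ⊆ A, B.Nonempty ∧ A.card ≤ 3 * B.card ∧
      (StrictMonoOn f (B : Set ℝ) ∨ StrictAntiOn f (B : Set ℝ)) := by
  obtain ⟨a, ha, hmin⟩ := A.exists_min_image f hne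
  have hlt : ∀ x ∈ A, ∀ y ∈ A, x ∈ openSegment ℝ a y → a ≠ y → f x < f y := by
    intro x _ y hy hxy hay
    have := hf.lt_on_openSegment (hA ha) (hA hy) hay hxy
    rwa [max_eq_right (hmin y hy)] at this
  have hright : StrictMonoOn f ((A.filter fun x => a < x : Finset ℝ) : Set ℝ) := by
    intro x hx y hy hxy
    obtain ⟨hx1, hx2⟩ := Finset.mem_filter.1 (Finset.mem_coe.1 hx)
    obtain ⟨hy1, hy2⟩ := Finset.mem_filter.1 (Finset.mem_coe.1 hy)
    exact hlt x hx1 y hy1 (by rw [openSegment_eq_Ioo hy2]; exact ⟨hx2, hxy⟩) hy2.ne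
  have hleft : StrictAntiOn f ((A.filter fun x => x < a : Finset ℝ) : Set ℝ) := by
    intro x hx y hy hxy
    obtain ⟨hx1, hx2⟩ := Finset.mem_filter.1 (Finset.mem_coe.1 hx)
    obtain ⟨hy1, hy2⟩ := Finset.mem_filter.1 (Finset.mem_coe.1 hy)
    exact hlt y hy1 x hx1
      (by rw [openSegment_symm, openSegment_eq_Ioo hx2]; exact ⟨hxy, hy2⟩) hx2.ne'
  have hcard : A.card ≤ (A.filter fun x => a < x).card + (A.filter fun x => x < a).card + 1 := by
    calc A.card ≤ (((A.filter fun x => a < x) ∪ A.filter fun x => x < a) ∪ {a}).card := by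
          refine Finset.card_le_card fun x hx => ?_
          simp only [Finset.mem_union, Finset.mem_filter, Finset.mem_singleton]
          rcases lt_trichotomy x a with h | h | h
          · exact Or.inl (Or.inr ⟨hx, h⟩)
          · exact Or.inr h
          · exact Or.inl (Or.inl ⟨hx, h⟩)
      _ ≤ _ := (Finset.card_union_le _ _).trans
          (Nat.add_le_add (Finset.card_union_le _ _) (Finset.card_singleton a).le)
  by_cases h1 : A.card ≤ 3 * (A.filter fun x => a < x).card
  · exact ⟨_, Finset.filter_subset _ _, Finset.card_pos.1 (by have := hne.card_pos; omega), h1,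
      Or.inl hright⟩
  by_cases h2 : A.card ≤ 3 * (A.filter fun x => x < a).card
  · exact ⟨_, Finset.filter_subset _ _, Finset.card_pos.1 (by have := hne.card_pos; omega), h2,
      Or.inr hleft⟩
  -- If both sides are smaller than a third, then `A` has at most one point.
  · refine ⟨{a}, by simpa using ha, by simp, ?_, Or.inl ?_⟩
    · rw [Finset.card_singleton]
      omega
    · rw [Finset.coe_singleton]
      exact Set.subsingleton_singleton.strictMonoOn f

theorem isSidonCurve_graph {f : ℝ → ℝ} {B : Finset ℝ}
    (hs : ∀ a ∈ B, ∀ b ∈ B, ∀ a' ∈ B, ∀ b' ∈ B, a ≠ b → a - b = a' - b' →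
      f a - f b = f a' - f b' → a = a')
    (hm : StrictMonoOn f (B : Set ℝ) ∨ StrictAntiOn f (B : Set ℝ)) :
    IsSidonCurve (B.image fun a => (a, f a)) where
  injOn_fst := by
    intro p hp q hq hpq
    simp only [Finset.coe_image, Set.mem_image, Finset.mem_coe] at hp hq
    obtain ⟨a, -, rfl⟩ := hp
    obtain ⟨b, -, rfl⟩ := hq
    simp only at hpq
    rw [hpq]
  injOn_snd := by
    intro p hp q hq hpq
    simp only [Finset.coe_image, Set.mem_image, Finset.mem_coe] at hp hq
    obtain ⟨a, ha, rfl⟩ := hp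
    obtain ⟨b, hb, rfl⟩ := hq
    have : a = b := hm.elim (fun h => h.injOn ha hb hpq) (fun h => h.injOn ha hb hpq)
    rw [this]
  sidon := by
    simp only [Finset.forall_mem_image, Prod.mk_sub_mk, Prod.mk.injEq]
    intro a ha b hb a' ha' b' hb' hne h
    have := hs a ha b hb a' ha' b' hb' (fun e => hne (by rw [e])) h.1 h.2
    exact ⟨this, by rw [this]⟩
  mono := by
    simp only [Finset.forall_mem_image]
    exact hm.imp (fun h a ha b hb hab => h.monotoneOn ha hb hab)
      (fun h a ha b hb hab => h.antitoneOn ha hb hab)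

theorem exists_subset_isSidonCurve {I : Set ℝ} {f : ℝ → ℝ}
    (hf : StrictConvexOn ℝ I f ∨ StrictConcaveOn ℝ I f) {A : Finset ℝ} (hA : (A : Set ℝ) ⊆ I)
    (hne : A.Nonempty) : ∃ B ⊆ A, B.Nonempty ∧ A.card ≤ 3 * B.card ∧
      IsSidonCurve (B.image fun a => (a, f a)) := by
  rcases hf with hf | hf
  · obtain ⟨B, hBA, hB, hc, hm⟩ := hf.exists_subset_strictMonoOn hA hne
    exact ⟨B, hBA, hB, hc, isSidonCurve_graph (fun a ha b hb a' ha' b' hb' =>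
      hf.eq_of_sub_eq_sub (hA (hBA ha)) (hA (hBA hb)) (hA (hBA ha')) (hA (hBA hb'))) hm⟩
  · have hf' : StrictConvexOn ℝ I (-f) := hf.neg
    obtain ⟨B, hBA, hB, hc, hm⟩ := hf'.exists_subset_strictMonoOn hA hne
    refine ⟨B, hBA, hB, hc, isSidonCurve_graph (fun a ha b hb a' ha' b' hb' hab h h' =>
      hf'.eq_of_sub_eq_sub (hA (hBA ha)) (hA (hBA hb)) (hA (hBA ha')) (hA (hBA hb')) hab h
        (by simp only [Pi.neg_apply]; linarith)) ?_⟩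
    refine hm.symm.imp (fun h a ha b hb hab => ?_) (fun h a ha b hb hab => ?_)
    · exact neg_lt_neg_iff.1 (h ha hb hab)
    · exact neg_lt_neg_iff.1 (h ha hb hab)

/-! ### Combining the energy bounds. -/

theorem addEnergy_sq_le (A B : Finset ℝ) :
    ((Finset.addEnergy A B : ℕ) : ℝ) ^ 2 ≤ energyTwo A * energyTwo B := by
  have h1 : ((Finset.addEnergy A B : ℕ) : ℝ) ≤
      ∑ x ∈ A - A, (diffRep A A x : ℝ) * diffRep B B x := by
    have h : Finset.addEnergy A B ≤ ((A - A).sigma fun x =>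
        ((A ×ˢ A).filter fun p => p.1 - p.2 = x) ×ˢ
        ((B ×ˢ B).filter fun p => p.1 - p.2 = x)).card := by
      refine Finset.card_le_card_of_injOn (fun q => ⟨q.1.1 - q.1.2, (q.1, q.2.swap)⟩) ?_ ?_
      · rintro ⟨⟨a, a'⟩, b, b'⟩ hq
        simp only [Finset.coe_filter, Finset.mem_product, Set.mem_ofPred_eq] at hq
        simp only [Finset.coe_sigma, Set.mem_sigma_iff, Finset.mem_coe, Finset.mem_product,
          Finset.mem_filter, Prod.swap_prod_mk]
        exact ⟨Finset.sub_mem_sub hq.1.1.1 hq.1.1.2, ⟨hq.1.1, trivial⟩,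
          ⟨hq.1.2.2, hq.1.2.1⟩, by linarith⟩
      · rintro ⟨⟨a, a'⟩, b, b'⟩ _ ⟨⟨c, c'⟩, d, d'⟩ _ he
        simp only [Sigma.mk.injEq, heq_eq_eq, Prod.mk.injEq, Prod.swap_prod_mk] at he ⊢
        tauto
    rw [Finset.card_sigma] at h
    simp only [Finset.card_product] at h
    exact_mod_cast h
  have h2 : ∑ x ∈ A - A, (diffRep B B x : ℝ) ^ 2 ≤ energyTwo B := by
    rw [energyTwo, ← Finset.sum_filter_add_sum_filter_not (A - A) (fun y => y ∈ B - B),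
      Finset.sum_eq_zero (s := (A - A).filter fun y => y ∉ B - B), add_zero]
    · exact Finset.sum_le_sum_of_subset_of_nonneg (fun y hy => (Finset.mem_filter.1 hy).2)
        fun _ _ _ => by positivity
    · intro y hy
      rw [diffRep_eq_zero (Finset.mem_filter.1 hy).2]
      simp
  calc ((Finset.addEnergy A B : ℕ) : ℝ) ^ 2
      ≤ (∑ x ∈ A - A, (diffRep A A x : ℝ) * diffRep B B x) ^ 2 := by gcongr
    _ ≤ energyTwo A * ∑ x ∈ A - A, (diffRep B B x : ℝ) ^ 2 := Finset.sum_mul_sq_le_sq_mul_sq _ _ _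
    _ ≤ _ := mul_le_mul_of_nonneg_left h2 (Finset.sum_nonneg fun _ _ => by positivity)

theorem card_pow_le_card_add_sq_mul_energyTwo (A B : Finset ℝ) :
    (A.card : ℝ) ^ 4 * (B.card : ℝ) ^ 4 ≤
      ((A + B).card : ℝ) ^ 2 * (energyTwo A * energyTwo B) := by
  have h : (A.card : ℝ) ^ 2 * (B.card : ℝ) ^ 2 ≤ (A + B).card * (Finset.addEnergy A B : ℕ) := by
    exact_mod_cast Finset.le_card_add_mul_addEnergy A B
  calc (A.card : ℝ) ^ 4 * (B.card : ℝ) ^ 4 = ((A.card : ℝ) ^ 2 * (B.card : ℝ) ^ 2) ^ 2 := by ring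
    _ ≤ (((A + B).card : ℝ) * ((Finset.addEnergy A B : ℕ) : ℝ)) ^ 2 := by gcongr
    _ = ((A + B).card : ℝ) ^ 2 * ((Finset.addEnergy A B : ℕ) : ℝ) ^ 2 := by ring
    _ ≤ _ := mul_le_mul_of_nonneg_left (addEnergy_sq_le A B) (by positivity)

theorem card_pow_algebra {m l k c F₁ F₂ DA DB σ E₁ E₂ s : ℝ} (hk : 0 ≤ k) (hc : 0 ≤ c)
    (hm : 0 ≤ m) (hl : 0 ≤ l) (hDA : 0 ≤ DA) (hE₁ : 0 ≤ E₁) (hE₂ : 0 ≤ E₂) (hs : 0 ≤ s) (hsσ : s ≤ σ)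
    (h₁ : m ^ 21 * E₁ ^ 9 ≤ k * l ^ 9 * σ ^ 10 * (DA * DB ^ 2) * F₂ ^ 2 * F₁ ^ 6)
    (h₂ : m ^ 21 * E₂ ^ 9 ≤ k * l ^ 9 * σ ^ 10 * (DB * DA ^ 2) * F₁ ^ 2 * F₂ ^ 6)
    (hE : m ^ 8 ≤ c * (s ^ 2 * (E₁ * E₂))) :
    m ^ 114 ≤ (c ^ 9 * k ^ 2) * l ^ 18 * (F₁ * F₂) ^ 8 * (DA * DB) ^ 3 * σ ^ 38 := by
  have hσ : 0 ≤ σ := hs.trans hsσ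
  have h3 : m ^ 8 ≤ c * (σ ^ 2 * (E₁ * E₂)) := by
    refine hE.trans ?_
    gcongr
  calc m ^ 114 = m ^ 42 * (m ^ 8) ^ 9 := by ring
    _ ≤ m ^ 42 * (c * (σ ^ 2 * (E₁ * E₂))) ^ 9 := by gcongr
    _ = c ^ 9 * σ ^ 18 * ((m ^ 21 * E₁ ^ 9) * (m ^ 21 * E₂ ^ 9)) := by ring
    _ ≤ c ^ 9 * σ ^ 18 *
        ((k * l ^ 9 * σ ^ 10 * (DA * DB ^ 2) * F₂ ^ 2 * F₁ ^ 6) *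
          (k * l ^ 9 * σ ^ 10 * (DB * DA ^ 2) * F₁ ^ 2 * F₂ ^ 6)) := by gcongr
    _ = _ := by ring

/-- The energy bound is used for the popular parts of both sets; their own sumset lies in A + B, so
Cauchy–Schwarz bounds the product of the two energies from below. Ninth powers match the exponents.
-/
theorem card_pow_le_of_cubeBound {A B : Finset ℝ} {m n : ℕ} (hm : 0 < m) (hA : A.card = m)
    (hB : B.card = m) (hmn : m ≤ n) {DA DB : ℝ} (hDA : 0 ≤ DA) (hDB : 0 ≤ DB)
    (hCA : CubeBound A DA) (hCB : CubeBound B DB) :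
    (m : ℝ) ^ 114 ≤ (65536 ^ 9 * (2 ^ 48) ^ 2) * (Nat.log 2 n + 1 : ℕ) ^ 18 *
      (energyThree A * energyThree B) ^ 8 * (DA * DB) ^ 3 * ((A + B).card : ℝ) ^ 38 := by
  have hMA := katzKoester_bound hm hA hB hmn hDA hCA hCB
  have hMB := katzKoester_bound hm hB hA hmn hDB hCB hCA
  rw [add_comm B A] at hMB
  have hA' := card_le_card_popularPart A B (Finset.card_pos.1 (by omega))
  have hB' := card_le_card_popularPart B A (Finset.card_pos.1 (by omega))
  rw [hA] at hA'
  rw [hB] at hB'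
  have hE := card_pow_le_card_add_sq_mul_energyTwo (popularPart A B) (popularPart B A)
  have hσ : ((popularPart A B + popularPart B A).card : ℝ) ≤ (A + B).card := by
    exact_mod_cast Finset.card_le_card
      (Finset.add_subset_add (Finset.filter_subset _ _) (Finset.filter_subset _ _))
  have hE1 : 0 ≤ energyTwo (popularPart A B) := Finset.sum_nonneg fun _ _ => by positivity
  have hE2 : 0 ≤ energyTwo (popularPart B A) := Finset.sum_nonneg fun _ _ => by positivity
  have hE' : (m : ℝ) ^ 8 ≤ 65536 * (((popularPart A B + popularPart B A).card : ℝ) ^ 2 *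
      (energyTwo (popularPart A B) * energyTwo (popularPart B A))) := by
    calc (m : ℝ) ^ 8 = (m : ℝ) ^ 4 * (m : ℝ) ^ 4 := by ring
      _ ≤ (4 * ((popularPart A B).card : ℝ)) ^ 4 * (4 * ((popularPart B A).card : ℝ)) ^ 4 := by
          gcongr
      _ = 65536 * (((popularPart A B).card : ℝ) ^ 4 * ((popularPart B A).card : ℝ) ^ 4) := by ring
      _ ≤ _ := by gcongr
  exact card_pow_algebra (by positivity) (by norm_num) (Nat.cast_nonneg _) (Nat.cast_nonneg _)
    hDA hE1 hE2 (Nat.cast_nonneg _) hσ hMA hMB hE'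

theorem energyThree_le_of_cubeBound {A : Finset ℝ} {D : ℝ} (h : CubeBound A D) :
    energyThree A ≤ D * (A.card : ℝ) ^ 2 := h A (A - A)

/-- Prune one coordinate, then swap and prune the other. The first estimate survives since
third-moment bounds and third energies are monotone under inclusion. -/
theorem exists_subsets_cubeBound {Γ : Finset (ℝ × ℝ)} (hΓ : IsSidonCurve Γ) (hne : Γ.Nonempty) :
    ∃ A ⊆ Γ.image Prod.fst, ∃ F ⊆ Γ.image Prod.snd, ∃ m : ℕ, 0 < m ∧ m ≤ Γ.card ∧
      A.card = m ∧ F.card = m ∧ (Γ.card : ℝ) ≤ 256 * (Nat.log 2 Γ.card + 1 : ℕ) ^ 4 * m ∧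
      ∃ DA DF : ℝ, 0 ≤ DA ∧ 0 ≤ DF ∧ CubeBound A DA ∧ CubeBound F DF ∧
        DA * energyThree F ≤ 3276800 * (Nat.log 2 Γ.card + 1 : ℕ) ^ 4 * (Γ.card : ℝ) ^ 5 ∧
        DF * energyThree A ≤ 3276800 * (Nat.log 2 Γ.card + 1 : ℕ) ^ 4 * (Γ.card : ℝ) ^ 5 := by
  have hΓ0 : (0 : ℝ) < Γ.card := by exact_mod_cast hne.card_pos
  obtain ⟨Δ, hΔ, hΔc, DA, hDA, hCA, hEA⟩ := exists_subset_cubeBound hΓ hne le_rfl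
  have hcurve := (hΓ.subset hΔ).swap
  have hswap : (Δ.image Prod.swap).card = Δ.card :=
    Finset.card_image_of_injective _ Prod.swap_injective
  have hΔne : Δ.Nonempty := by
    rw [Finset.nonempty_iff_ne_empty]
    rintro rfl
    simp only [Finset.card_empty, Nat.cast_zero, mul_zero] at hΔc
    linarith
  obtain ⟨Δ', hΔ', hΔ'c, DF, hDF, hCF, hEF⟩ := exists_subset_cubeBound hcurve (hΔne.image _)
    (hswap.trans_le (Finset.card_le_card hΔ))
  rw [hswap] at hΔ'c
  have hcurve' := hcurve.subset hΔ'
  have hsub : ∀ p ∈ Δ', p.swap ∈ Δ := fun p hp => by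
    obtain ⟨q, hq, rfl⟩ := Finset.mem_image.1 (hΔ' hp)
    simpa using hq
  have hA : Δ'.image Prod.snd ⊆ Δ.image Prod.fst := by
    refine Finset.image_subset_iff.2 fun p hp => ?_
    exact Finset.mem_image.2 ⟨p.swap, hsub p hp, rfl⟩
  have hF : Δ'.image Prod.fst ⊆ Δ.image Prod.snd := by
    refine Finset.image_subset_iff.2 fun p hp => ?_
    exact Finset.mem_image.2 ⟨p.swap, hsub p hp, rfl⟩
  have hcard : (Γ.card : ℝ) ≤ 256 * (Nat.log 2 Γ.card + 1 : ℕ) ^ 4 * Δ'.card := by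
    calc (Γ.card : ℝ) ≤ 16 * (Nat.log 2 Γ.card + 1 : ℕ) ^ 2 * Δ.card := hΔc
      _ ≤ 16 * (Nat.log 2 Γ.card + 1 : ℕ) ^ 2 *
          (16 * (Nat.log 2 Γ.card + 1 : ℕ) ^ 2 * Δ'.card) := by gcongr
      _ = _ := by ring
  refine ⟨Δ'.image Prod.snd, hA.trans (Finset.image_subset_image hΔ), Δ'.image Prod.fst,
    hF.trans (Finset.image_subset_image hΔ), Δ'.card, ?_, ?_,
    Finset.card_image_of_injOn hcurve'.injOn_snd, Finset.card_image_of_injOn hcurve'.injOn_fst,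
    hcard, DA, DF, hDA, hDF, hCA.subset hA, hCF, ?_, hEF⟩
  · by_contra h0
    have h1 : Δ'.card = 0 := by omega
    rw [h1, Nat.cast_zero, mul_zero] at hcard
    linarith
  · exact (Finset.card_le_card hΔ').trans (hswap.trans_le (Finset.card_le_card hΔ))
  · exact (mul_le_mul_of_nonneg_left (energyThree_mono hF) hDA).trans hEA

/-- Only UV has a direct bound, but U occurs to a higher power than V; U ≤ Vn⁴ converts the excess
U¹⁰ into (UV)⁵n²⁰. -/
theorem final_algebra {n m l U V W c₁ c₂ c₃ : ℝ} (hn : 0 < n) (hU : 0 ≤ U)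
    (hV : 0 ≤ V) (hc₂ : 0 ≤ c₂)
    (hnm : n ≤ c₁ * l ^ 4 * m)
    (hUV : U * V ≤ c₃ * l ^ 8 * n ^ 10) (hUn : U ≤ V * n ^ 4)
    (h : (m ^ 114) ^ 2 ≤ c₂ * l ^ 36 * U ^ 16 * V ^ 6 * W ^ 38) :
    n ^ 98 ≤ c₁ ^ 228 * c₂ * c₃ ^ 11 * l ^ 1036 * W ^ 38 := by
  have hU2 : U ^ 2 ≤ U * V * n ^ 4 := by
    calc U ^ 2 = U * U := by ring
      _ ≤ U * (V * n ^ 4) := by gcongr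
      _ = _ := by ring
  have hUV16 : U ^ 16 * V ^ 6 ≤ c₃ ^ 11 * l ^ 88 * n ^ 130 := by
    calc U ^ 16 * V ^ 6 = (U * V) ^ 6 * (U ^ 2) ^ 5 := by ring
      _ ≤ (U * V) ^ 6 * (U * V * n ^ 4) ^ 5 := by gcongr
      _ = (U * V) ^ 11 * n ^ 20 := by ring
      _ ≤ (c₃ * l ^ 8 * n ^ 10) ^ 11 * n ^ 20 := by gcongr
      _ = _ := by ring
  have hmain : n ^ 130 * n ^ 98 ≤
      n ^ 130 * (c₁ ^ 228 * c₂ * c₃ ^ 11 * l ^ 1036 * W ^ 38) := by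
    calc n ^ 130 * n ^ 98 = n ^ 228 := by rw [← pow_add]
      _ ≤ (c₁ * l ^ 4 * m) ^ 228 := by gcongr
      _ = c₁ ^ 228 * l ^ 912 * (m ^ 114) ^ 2 := by
          rw [mul_pow, mul_pow, ← pow_mul, ← pow_mul]
      _ ≤ c₁ ^ 228 * l ^ 912 * (c₂ * l ^ 36 * U ^ 16 * V ^ 6 * W ^ 38) := by gcongr
      _ = c₁ ^ 228 * l ^ 912 * (c₂ * l ^ 36 * (U ^ 16 * V ^ 6) * W ^ 38) := by ring
      _ ≤ c₁ ^ 228 * l ^ 912 * (c₂ * l ^ 36 * (c₃ ^ 11 * l ^ 88 * n ^ 130) * W ^ 38) := by gcongr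
      _ = _ := by
          have : l ^ 1036 = l ^ 912 * l ^ 36 * l ^ 88 := by rw [← pow_add, ← pow_add]
          rw [this]
          ring
  exact le_of_mul_le_mul_left hmain (by positivity)

theorem exists_const_card_pow_le : ∃ C : ℝ, 0 ≤ C ∧ ∀ Γ : Finset (ℝ × ℝ), IsSidonCurve Γ →
    Γ.Nonempty → ∀ A F : Finset ℝ, Γ.image Prod.fst ⊆ A → Γ.image Prod.snd ⊆ F →
    ((Γ.card : ℝ) ^ 98 ≤ C * (Nat.log 2 Γ.card + 1 : ℕ) ^ 1036 * (((A + F).card : ℝ) ^ 2) ^ 38) ∧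
    ((Γ.card : ℝ) ^ 98 ≤ C * (Nat.log 2 Γ.card + 1 : ℕ) ^ 1036 *
      (((A + A).card : ℝ) * ((F + F).card : ℝ)) ^ 38) := by
  obtain ⟨c₁, hc₁⟩ : ∃ c : ℝ, c = 256 := ⟨_, rfl⟩
  obtain ⟨c₂, hc₂⟩ : ∃ c : ℝ, c = 65536 ^ 9 * (2 ^ 48) ^ 2 := ⟨_, rfl⟩
  obtain ⟨c₃, hc₃⟩ : ∃ c : ℝ, c = 3276800 := ⟨_, rfl⟩
  have hc₁0 : 0 ≤ c₁ := by rw [hc₁]; norm_num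
  have hc₂0 : 0 ≤ c₂ := by rw [hc₂]; positivity
  have hc₃0 : 0 ≤ c₃ := by rw [hc₃]; norm_num
  refine ⟨c₁ ^ 228 * c₂ ^ 2 * (c₃ ^ 2) ^ 11, by positivity, fun Γ hΓ hne A F hA hF => ?_⟩
  obtain ⟨A', hA', F', hF', m, hm, hmn, hAm, hFm, hn, DA, DF, hDA, hDF, hCA, hCF, hEF, hEA⟩ :=
    exists_subsets_cubeBound hΓ hne
  have h := card_pow_le_of_cubeBound hm hAm hFm hmn hDA hDF hCA hCF
  have h1 := card_pow_le_of_cubeBound hm hAm hAm hmn hDA hDA hCA hCA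
  have h2 := card_pow_le_of_cubeBound hm hFm hFm hmn hDF hDF hCF hCF
  rw [← hc₁] at hn
  rw [← hc₂] at h h1 h2
  rw [← hc₃] at hEF hEA
  have hΓ0 : (0 : ℝ) < Γ.card := by exact_mod_cast hne.card_pos
  have hmn' : (m : ℝ) ≤ Γ.card := by exact_mod_cast hmn
  have h3A := energyThree_nonneg A'
  have h3F := energyThree_nonneg F'
  have hm0 : (0 : ℝ) ≤ m := Nat.cast_nonneg _
  have hl : (0 : ℝ) ≤ (Nat.log 2 Γ.card + 1 : ℕ) := Nat.cast_nonneg _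
  have hcardle : ∀ {X Y X' Y' : Finset ℝ}, X ⊆ X' → Y ⊆ Y' →
      ((X + Y).card : ℝ) ≤ (X' + Y').card := fun h h' => by
    exact_mod_cast Finset.card_le_card (Finset.add_subset_add h h')
  have hle := hcardle (hA'.trans hA) (hF'.trans hF)
  have hle1 := hcardle (hA'.trans hA) (hA'.trans hA)
  have hle2 := hcardle (hF'.trans hF) (hF'.trans hF)
  have hs : (0 : ℝ) ≤ (A' + F').card := Nat.cast_nonneg _
  have hs1 : (0 : ℝ) ≤ (A' + A').card := Nat.cast_nonneg _
  have hs2 : (0 : ℝ) ≤ (F' + F').card := Nat.cast_nonneg _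
  have hEA' := energyThree_le_of_cubeBound hCA
  have hEF' := energyThree_le_of_cubeBound hCF
  rw [hAm] at hEA'
  rw [hFm] at hEF'
  generalize ((Nat.log 2 Γ.card + 1 : ℕ) : ℝ) = l at *
  generalize energyThree A' = E₁ at *
  generalize energyThree F' = E₂ at *
  generalize ((A' + F').card : ℝ) = s at *
  generalize ((A' + A').card : ℝ) = s₁ at *
  generalize ((F' + F').card : ℝ) = s₂ at *
  generalize ((A + F).card : ℝ) = σ at *
  generalize ((A + A).card : ℝ) = σ₁ at *
  generalize ((F + F).card : ℝ) = σ₂ at *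
  have hσ₁ := hs1.trans hle1
  have hσ₂ := hs2.trans hle2
  have hUV : E₁ * E₂ * (DA * DF) ≤ c₃ ^ 2 * l ^ 8 * (Γ.card : ℝ) ^ 10 := by
    calc E₁ * E₂ * (DA * DF) = (DA * E₂) * (DF * E₁) := by ring
      _ ≤ _ := mul_le_mul hEF hEA (by positivity) (by positivity)
      _ = _ := by ring
  have hUn : E₁ * E₂ ≤ DA * DF * (Γ.card : ℝ) ^ 4 := by
    calc E₁ * E₂ ≤ (DA * (m : ℝ) ^ 2) * (DF * (m : ℝ) ^ 2) :=
          mul_le_mul hEA' hEF' h3F (by positivity)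
      _ = DA * DF * (m : ℝ) ^ 4 := by ring
      _ ≤ _ := by gcongr
  refine ⟨final_algebra hΓ0 (mul_nonneg h3A h3F) (mul_nonneg hDA hDF)
    (by positivity) hn hUV hUn ?_,
    final_algebra hΓ0 (mul_nonneg h3A h3F) (mul_nonneg hDA hDF)
    (by positivity) hn hUV hUn ?_⟩
  · calc ((m : ℝ) ^ 114) ^ 2
        ≤ (c₂ * l ^ 18 * (E₁ * E₂) ^ 8 * (DA * DF) ^ 3 * s ^ 38) ^ 2 := by gcongr
      _ = c₂ ^ 2 * l ^ 36 * (E₁ * E₂) ^ 16 * (DA * DF) ^ 6 * (s ^ 2) ^ 38 := by ring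
      _ ≤ _ := by gcongr
  · calc ((m : ℝ) ^ 114) ^ 2 = (m : ℝ) ^ 114 * (m : ℝ) ^ 114 := by rw [sq]
      _ ≤ (c₂ * l ^ 18 * (E₁ * E₁) ^ 8 * (DA * DA) ^ 3 * s₁ ^ 38) *
          (c₂ * l ^ 18 * (E₂ * E₂) ^ 8 * (DF * DF) ^ 3 * s₂ ^ 38) :=
        mul_le_mul h1 h2 (by positivity) (by positivity)
      _ = c₂ ^ 2 * l ^ 36 * (E₁ * E₂) ^ 16 * (DA * DF) ^ 6 * (s₁ * s₂) ^ 38 := by ring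
      _ ≤ _ := by gcongr

/-! ### Extracting the exponent 49/38. -/

theorem natLog_two_add_one_le {n : ℕ} (hn : 0 < n) :
    ((Nat.log 2 n + 1 : ℕ) : ℝ) ≤ 2 * (1 + Real.log n) := by
  have h1 : (Nat.log 2 n : ℝ) * Real.log 2 ≤ Real.log n := by
    rw [← Real.log_pow]
    refine Real.log_le_log (by positivity) ?_
    exact_mod_cast Nat.pow_log_le_self 2 hn.ne'
  have h2 := Real.log_two_gt_d9
  have h3 : (0 : ℝ) ≤ Nat.log 2 n := Nat.cast_nonneg _
  push_cast
  nlinarith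

/-- The constant 1/(1 + X) avoids a 76th root of X: its 76th power times X is still at most 1. The
exponents match as 76 · 49/38 = 98 and 76 · 14 = 1064. -/
theorem rpow_div_le_of_pow_le {X N L s : ℝ} (hX : 0 ≤ X) (hN : 0 ≤ N) (hL : 0 < L)
    (hs : 0 ≤ s) (h : N ^ 98 ≤ X * L ^ 1064 * s ^ 76) :
    1 / (1 + X) * N ^ (49 / 38 : ℝ) / L ^ 14 ≤ s := by
  refine le_of_pow_le_pow_left₀ (n := 76) (by norm_num) hs ?_
  have h1 : (N ^ (49 / 38 : ℝ)) ^ 76 = N ^ 98 := by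
    rw [← Real.rpow_natCast, ← Real.rpow_mul hN, ← Real.rpow_natCast N 98]
    norm_num
  have hc : (1 / (1 + X)) ^ 76 * X ≤ 1 := by
    have h2 : (1 / (1 + X)) ^ 76 ≤ 1 / (1 + X) := by
      refine pow_le_of_le_one (by positivity) ?_ (by norm_num)
      rw [div_le_one (by positivity)]
      linarith
    calc (1 / (1 + X)) ^ 76 * X ≤ 1 / (1 + X) * X := by gcongr
      _ ≤ 1 := by
          rw [one_div, inv_mul_le_iff₀ (by positivity)]
          linarith
  rw [div_pow, mul_pow, h1, ← pow_mul, div_le_iff₀ (by positivity)]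
  calc (1 / (1 + X)) ^ 76 * N ^ 98 ≤ (1 / (1 + X)) ^ 76 * (X * L ^ 1064 * s ^ 76) := by gcongr
    _ = (1 / (1 + X)) ^ 76 * X * (s ^ 76 * L ^ 1064) := by ring
    _ ≤ s ^ 76 * L ^ 1064 :=
        mul_le_of_le_one_left (mul_nonneg (pow_nonneg hs _) (pow_nonneg hL.le _)) hc

theorem mainTheorem3 :
    ∃ (c : ℝ) (K : ℕ), 0 < c ∧
      ∀ (I : Set ℝ) (f : ℝ → ℝ), (StrictConvexOn ℝ I f ∨ StrictConcaveOn ℝ I f) →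
        ∀ A : Finset ℝ, (A : Set ℝ) ⊆ I →
          c * (A.card : ℝ) ^ (49 / 38 : ℝ) / (1 + Real.log (A.card : ℝ)) ^ K
              ≤ ((A + A.image f).card : ℝ) ∧
          c * (A.card : ℝ) ^ (49 / 38 : ℝ) / (1 + Real.log (A.card : ℝ)) ^ K
              ≤ ((A + A).card : ℝ) + ((A.image f + A.image f).card : ℝ) := by
  obtain ⟨C, hC, hmain⟩ := exists_const_card_pow_le
  obtain ⟨a, ha⟩ : ∃ a : ℝ, a = 3 ^ 98 := ⟨_, rfl⟩
  have ha0 : 0 ≤ a := by rw [ha]; positivity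
  obtain ⟨b, hb⟩ : ∃ b : ℝ, b = 2 := ⟨_, rfl⟩
  have hb0 : 0 ≤ b := by rw [hb]; norm_num
  have hX : 0 ≤ a * C * b ^ 1064 := by positivity
  refine ⟨1 / (1 + a * C * b ^ 1064), 14, by positivity, fun I f hf A hA => ?_⟩
  rcases A.eq_empty_or_nonempty with rfl | hne
  · have h0 : ((0 : ℕ) : ℝ) ^ (49 / 38 : ℝ) = 0 := by
      rw [Nat.cast_zero, Real.zero_rpow (by norm_num)]
    simp only [Finset.card_empty, h0, mul_zero, zero_div]
    exact ⟨Nat.cast_nonneg _, by positivity⟩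
  obtain ⟨B, hBA, hB, hcard, hcurve⟩ := exists_subset_isSidonCurve hf hA hne
  have hΓc : (B.image fun x => (x, f x)).card = B.card :=
    Finset.card_image_of_injective _ fun x y hxy => (Prod.ext_iff.1 hxy).1
  have hfst : (B.image fun x => (x, f x)).image Prod.fst ⊆ A := by
    rw [Finset.image_image]
    exact Finset.image_subset_iff.2 fun x hx => hBA hx
  have hsnd : (B.image fun x => (x, f x)).image Prod.snd ⊆ A.image f := by
    rw [Finset.image_image]
    exact Finset.image_subset_iff.2 fun x hx => Finset.mem_image_of_mem f (hBA hx)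
  obtain ⟨h1, h2⟩ := hmain _ hcurve (hB.image _) A (A.image f) hfst hsnd
  rw [hΓc] at h1 h2
  have hL1 : 1 ≤ 1 + Real.log A.card := by
    have := Real.log_natCast_nonneg A.card
    linarith
  have hl : ((Nat.log 2 B.card + 1 : ℕ) : ℝ) ≤ b * (1 + Real.log A.card) := by
    rw [hb]
    refine le_trans ?_ (natLog_two_add_one_le hne.card_pos)
    exact_mod_cast Nat.succ_le_succ (Nat.log_mono_right (Finset.card_le_card hBA))
  have hl1 : (1 : ℝ) ≤ (Nat.log 2 B.card + 1 : ℕ) := by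
    exact_mod_cast Nat.succ_le_succ (Nat.zero_le _)
  have hcard' : (A.card : ℝ) ^ 98 ≤ a * (B.card : ℝ) ^ 98 := by
    rw [ha, ← mul_pow]
    have : (A.card : ℝ) ≤ 3 * B.card := by exact_mod_cast hcard
    gcongr
  generalize ((Nat.log 2 B.card + 1 : ℕ) : ℝ) = l at *
  generalize 1 + Real.log A.card = L at *
  have hl1064 : l ^ 1036 ≤ b ^ 1064 * L ^ 1064 := by
    -- The exponent is raised to 1064, the next multiple of 76.
    calc l ^ 1036 ≤ l ^ 1064 := pow_le_pow_right₀ hl1 (by norm_num)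
      _ ≤ (b * L) ^ 1064 := by gcongr
      _ = _ := mul_pow _ _ _
  have hfinal : ∀ s W : ℝ, 0 ≤ W → W ≤ s ^ 2 → (B.card : ℝ) ^ 98 ≤ C * l ^ 1036 * W ^ 38 →
      (A.card : ℝ) ^ 98 ≤ a * C * b ^ 1064 * L ^ 1064 * s ^ 76 := by
    intro s W hW hWs h
    calc (A.card : ℝ) ^ 98 ≤ a * (B.card : ℝ) ^ 98 := hcard'
      _ ≤ a * (C * l ^ 1036 * W ^ 38) := by gcongr
      _ ≤ a * (C * (b ^ 1064 * L ^ 1064) * (s ^ 2) ^ 38) := by gcongr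
      _ = _ := by rw [← pow_mul]; ring
  have hL0 : 0 < L := by linarith
  refine ⟨rpow_div_le_of_pow_le hX (Nat.cast_nonneg _) hL0 (Nat.cast_nonneg _)
    (hfinal _ _ (by positivity) le_rfl h1), rpow_div_le_of_pow_le hX (Nat.cast_nonneg _) hL0
    (by positivity) (hfinal _ _ (by positivity) ?_ h2)⟩
  have h3 : (0 : ℝ) ≤ (A + A).card := Nat.cast_nonneg _
  have h4 : (0 : ℝ) ≤ (A.image f + A.image f).card := Nat.cast_nonneg _
  -- The product of the two sumset sizes is at most the square of their sum.
  nlinarith
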